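/- Let $n\ge 1$ (for $T^{[1^n]}_{[n-1,1]}(SU(n))$, $n\ge 2$). Consider the vertex superalgebra $V$ over $\mathbb{C}$, realised on its Fock space, that is generated by symplectic bosons $X_i,Y_i$ (even, $1\le i\le n$), fermi multiplets $\psi_i,\chi_i$ (odd, $1\le i\le n$) and ghosts $b_a,c^a$ (odd, $1\le a\le n-1$), whose only singular operator products are $$X_i(z)Y_j(0)\sim\frac{\delta_{ij}}{z},\qquad \psi_i(z)\chi_j(0)\sim\frac{\delta_{ij}}{z},\qquad b_a(z)c^{b}(0)\sim\frac{\delta_a^{b}}{z}$$ (and those with the two factors exchanged). For fields $A,B$ let $AB$ be the normally ordered product $(AB)_0(w)=\oint\frac{dz}{2\pi i}\frac{A(z)B(w)}{z-w}$, with longer products nested to the right, $ABC=A(BC)$, and let $[A,B]:=AB-BA$ be the commutator for this product (also when $A$, $B$ are odd). Put $$J_{BRST}=\sum_{a=1}^{n-1}c^a\left(X_aY_a-X_{a+1}Y_{a+1}+\psi_a\chi_a-\psi_{a+1}\chi_{a+1}\right),\qquad Q=\oint\frac{dz}{2\pi i}J_{BRST}(z),$$ and write $A\equiv B$ if $A-B=QC$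 for some $C\in V$. Define $$\mathcal A_i=-X_iY_i,\qquad \hat{\mathcal A}_i\mathcal O=\mathcal A_i\mathcal O,\qquad \mathcal D_i\mathcal O=\mathcal A_i\mathcal O+X_i(Y_i\mathcal O),$$ $$T_i=\tfrac12(\mathcal D_i+\hat{\mathcal A}_i)\mathcal A_i,\qquad W_i=\tfrac13\sqrt{\tfrac23}\left\{\mathcal D_i(\mathcal D_i\mathcal A_i)+\tfrac12\mathcal D_i(\hat{\mathcal A}_i\mathcal A_i)+\tfrac12\hat{\mathcal A}_i(\mathcal D_i\mathcal A_i)+\hat{\mathcal A}_i(\hat{\mathcal A}_i\mathcal A_i)\right\},$$ $$U=-\frac1n\sum_{i=1}^nX_iY_i,\qquad U_F=-\frac1n\sum_{i=1}^n\psi_i\chi_i,\qquad M_i^+=X_i\psi_i,\qquad M_i^-=Y_i\chi_i.$$ Then for every $i\in\{1,\dots,n\}$: 1. $$W_i\equiv\tfrac13\sqrt{\tfrac23}\left\{\tfrac32\left(M_i^+\partial M_i^-+M_i^-\partial M_i^+\right)-\tfrac32(U+U_F)[M_i^+,M_i^-]+(U+U_F)^3+\partial^2(U+U_F)\right\};$$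 2. $$T_i\equiv\tfrac12(U+U_F)^2-\tfrac12[M_i^+,M_i^-];$$ 3. the pair $(T_i,W_i)$ is generated, in the BRST cohomology, by $U+U_F$ and $M_i^\pm$: every element of the vertex subalgebra generated by $T_i$ and $W_i$ is $Q$-closed and is $\equiv$ to a $Q$-closed element of the vertex subalgebra generated by $U+U_F$, $M_i^+$ and $M_i^-$. -/

import Mathlib

open scoped TensorProduct

noncomputable section

namespace BoundaryVOA

/-! ### The Fock space

Creation modes `X_{i,(-k-1)}`, `Y_{i,(-k-1)}` are the polynomial variables indexed by
`(X i, k)`, `(Y i, k)`; creation modes of the anticommuting fields `ψ_i`, `χ_i`, `b_a`, `c^a` are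
the exterior generators indexed in the same way. -/

/-- The symplectic bosons `X_i`, `Y_i`, for `i = 1, …, n`. -/
inductive Boson (n : ℕ) : Type
  | X (i : Fin n)
  | Y (i : Fin n)

/-- The fermi multiplets `ψ_i`, `χ_i`, for `i = 1, …, n`, and the ghosts `b_a`, `c^a`, for
`a = 1, …, n - 1`. -/
inductive Fermion (n : ℕ) : Type
  | psi (i : Fin n)
  | chi (i : Fin n)
  | b (a : Fin (n - 1))
  | c (a : Fin (n - 1))

/-- Bosonic Fock space. -/
abbrev BosonFock (n : ℕ) : Type := MvPolynomial (Boson n × ℕ) ℂ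

/-- Fermionic Fock space. -/
abbrev FermionFock (n : ℕ) : Type := ExteriorAlgebra ℂ ((Fermion n × ℕ) →₀ ℂ)

/-- The state space of the symplectic bosons, the fermi multiplets and the ghosts. -/
def Fock (n : ℕ) : Type := BosonFock n ⊗[ℂ] FermionFock n

instance (n : ℕ) : AddCommGroup (Fock n) :=
  inferInstanceAs (AddCommGroup (BosonFock n ⊗[ℂ] FermionFock n))

instance (n : ℕ) : Module ℂ (Fock n) :=
  inferInstanceAs (Module ℂ (BosonFock n ⊗[ℂ] FermionFock n))

variable {n : ℕ}

/-- The identification of the tensor product with the state space. -/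
def fockEquiv : (BosonFock n ⊗[ℂ] FermionFock n) ≃ₗ[ℂ] Fock n := LinearEquiv.refl ℂ _

/-- The parity involution `(-1)^F` of the Fock space. -/
def parity : Module.End ℂ (Fock n) :=
  fockEquiv.conj (LinearMap.lTensor (BosonFock n)
    (CliffordAlgebra.involute : FermionFock n →ₐ[ℂ] FermionFock n).toLinearMap)

/-- Multiplication by a bosonic variable. -/
def createB (s : Boson n) (k : ℕ) : Module.End ℂ (Fock n) :=
  fockEquiv.conj (LinearMap.rTensor (FermionFock n)
    (LinearMap.mulLeft ℂ (MvPolynomial.X (s, k) : BosonFock n)))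

/-- Differentiation with respect to a bosonic variable. -/
def removeB (s : Boson n) (k : ℕ) : Module.End ℂ (Fock n) :=
  fockEquiv.conj (LinearMap.rTensor (FermionFock n)
    (MvPolynomial.pderiv (s, k) : Derivation ℂ (BosonFock n) (BosonFock n)).toLinearMap)

/-- Left multiplication by a fermionic generator. -/
def createF (s : Fermion n) (k : ℕ) : Module.End ℂ (Fock n) :=
  fockEquiv.conj (LinearMap.lTensor (BosonFock n)
    (LinearMap.mulLeft ℂ (ExteriorAlgebra.ι ℂ (Finsupp.single (s, k) (1 : ℂ)))))

/-- Contraction with the dual of a fermionic generator. -/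
def removeF (s : Fermion n) (k : ℕ) : Module.End ℂ (Fock n) :=
  fockEquiv.conj (LinearMap.lTensor (BosonFock n)
    (CliffordAlgebra.contractLeft (Q := (0 : QuadraticForm ℂ ((Fermion n × ℕ) →₀ ℂ)))
      (Finsupp.lapply (s, k))))

/-- It suffices to check annihilation on pure tensors. -/
theorem eventually_of_tmul (f : ℕ → Module.End ℂ (Fock n))
    (h : ∀ (p : BosonFock n) (w : FermionFock n), ∃ N, ∀ k ≥ N, f k (fockEquiv (p ⊗ₜ w)) = 0)
    (v : Fock n) : ∃ N, ∀ k ≥ N, f k v = 0 := by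
  obtain ⟨t, rfl⟩ := fockEquiv.surjective v
  induction t using TensorProduct.induction_on with
  | zero => exact ⟨0, fun k _ => by rw [map_zero, map_zero]⟩
  | tmul p w => exact h p w
  | add x y hx hy =>
    obtain ⟨N, hN⟩ := hx
    obtain ⟨M, hM⟩ := hy
    refine ⟨max N M, fun k hk => ?_⟩
    rw [map_add, map_add, hN k (le_trans (le_max_left _ _) hk),
      hM k (le_trans (le_max_right _ _) hk), add_zero]

theorem removeB_eventually (s : Boson n) (v : Fock n) : ∃ N, ∀ k ≥ N, removeB s k v = 0 := by
  classical
  refine eventually_of_tmul (removeB s) (fun p w => ?_) v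
  refine ⟨(p.vars.image Prod.snd).sup id + 1, fun k hk => ?_⟩
  have hnot : (s, k) ∉ p.vars := by
    intro hmem
    have h1 : k ≤ (p.vars.image Prod.snd).sup id :=
      Finset.le_sup (f := id) (Finset.mem_image_of_mem Prod.snd hmem)
    omega
  have h2 : MvPolynomial.pderiv (s, k) p = 0 :=
    MvPolynomial.pderiv_eq_zero_of_notMem_vars hnot
  simp [removeB, LinearEquiv.conj_apply, h2]

theorem removeF_eventually (s : Fermion n) (v : Fock n) : ∃ N, ∀ k ≥ N, removeF s k v = 0 := by
  classical
  have key : ∀ w : FermionFock n, ∃ N, ∀ k ≥ N,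
      CliffordAlgebra.contractLeft (Q := (0 : QuadraticForm ℂ ((Fermion n × ℕ) →₀ ℂ)))
        (Finsupp.lapply (s, k)) w = 0 := by
    intro w
    induction w using CliffordAlgebra.left_induction with
    | algebraMap r => exact ⟨0, fun k _ => by
        rw [CliffordAlgebra.contractLeft_algebraMap]⟩
    | add x y hx hy =>
      obtain ⟨N, hN⟩ := hx
      obtain ⟨M, hM⟩ := hy
      refine ⟨max N M, fun k hk => ?_⟩
      rw [map_add, hN k (le_trans (le_max_left _ _) hk), hM k (le_trans (le_max_right _ _) hk),
        add_zero]
    | ι_mul x m hx =>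
      obtain ⟨N, hN⟩ := hx
      refine ⟨max N ((m.support.image Prod.snd).sup id + 1), fun k hk => ?_⟩
      have hm : m (s, k) = 0 := by
        by_contra hne
        have hmem : (s, k) ∈ m.support := Finsupp.mem_support_iff.2 hne
        have h1 : k ≤ (m.support.image Prod.snd).sup id :=
          Finset.le_sup (f := id) (Finset.mem_image_of_mem Prod.snd hmem)
        have h2 := le_trans (le_max_right N _) hk
        omega
      rw [CliffordAlgebra.contractLeft_ι_mul, hN k (le_trans (le_max_left _ _) hk)]
      simp [hm]
  refine eventually_of_tmul (removeF s) (fun p w => ?_) v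
  obtain ⟨N, hN⟩ := key w
  refine ⟨N, fun k hk => ?_⟩
  simp [removeF, LinearEquiv.conj_apply, hN k hk]

/-! ### Fields -/

/-- Fields `A(z) = ∑_m A_{(m)} z^{-m-1}` on the Fock space; `A_{(m)}` is
`VertexOperator.ncoeff A m`. -/
abbrev FockField (n : ℕ) : Type := VertexOperator ℂ (Fock n)

/-- The field with prescribed modes `A_{(m)}`. -/
def ofModes (f : ℤ → Module.End ℂ (Fock n)) (hf : ∀ v, ∃ N : ℤ, ∀ m ≥ N, f m v = 0) :
    FockField n :=
  VertexOperator.of_coeff (fun k => f (-k - 1)) (by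
    intro v
    obtain ⟨N, hN⟩ := hf v
    refine ⟨-N, fun k hk => ?_⟩
    by_contra hlt
    exact hk (hN _ (by omega)))

theorem ncoeff_ofModes (f : ℤ → Module.End ℂ (Fock n))
    (hf : ∀ v, ∃ N : ℤ, ∀ m ≥ N, f m v = 0) (m : ℤ) :
    VertexOperator.ncoeff (ofModes f hf) m = f m := by
  rw [ofModes, VertexOperator.ncoeff_of_coeff]
  congr 1
  ring

theorem ncoeff_eventually (A : FockField n) (v : Fock n) :
    ∃ N : ℤ, ∀ m ≥ N, VertexOperator.ncoeff A m v = 0 := by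
  refine ⟨-HahnSeries.order ((HahnModule.of ℂ).symm (A v)), fun m hm => ?_⟩
  exact VertexOperator.ncoeff_eq_zero_of_lt_order A m v (by omega)

/-- The identity field. -/
def one : FockField n :=
  ofModes (fun m => if m = -1 then 1 else 0) (fun v => ⟨0, fun m hm => by
    rw [if_neg (by omega), LinearMap.zero_apply]⟩)

/-- The modes of a free field: `create k` in degree `-k-1` and `remove k` in degree `k`. -/
def freeMode (create remove : ℕ → Module.End ℂ (Fock n)) : ℤ → Module.End ℂ (Fock n)
  | Int.ofNat k => remove k
  | Int.negSucc k => create k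

theorem freeMode_eventually (create remove : ℕ → Module.End ℂ (Fock n))
    (h : ∀ v, ∃ N, ∀ k ≥ N, remove k v = 0) (v : Fock n) :
    ∃ N : ℤ, ∀ m ≥ N, freeMode create remove m v = 0 := by
  obtain ⟨N, hN⟩ := h v
  refine ⟨N, fun m hm => ?_⟩
  obtain ⟨k, rfl⟩ := Int.eq_ofNat_of_zero_le (le_trans (Int.natCast_nonneg N) hm)
  exact hN k (by exact_mod_cast hm)

/-- `X_i(z)`, with `X_i(z) Y_j(0) ∼ δ_{ij} / z`. -/
def X (i : Fin n) : FockField n :=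
  ofModes (freeMode (createB (.X i)) (removeB (.Y i)))
    (freeMode_eventually _ _ (removeB_eventually _))

/-- `Y_i(z)`; since `X_i`, `Y_i` are bosonic, `Y_i(z) X_j(0) ∼ -δ_{ij} / z`. -/
def Y (i : Fin n) : FockField n :=
  ofModes (freeMode (createB (.Y i)) (fun k => -removeB (.X i) k))
    (freeMode_eventually _ _ (fun v => by
      obtain ⟨N, hN⟩ := removeB_eventually (.X i) v
      exact ⟨N, fun k hk => by rw [LinearMap.neg_apply, hN k hk, neg_zero]⟩))

/-- `ψ_i(z)`, with `ψ_i(z) χ_j(0) ∼ δ_{ij} / z`. -/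
def psi (i : Fin n) : FockField n :=
  ofModes (freeMode (createF (.psi i)) (removeF (.chi i)))
    (freeMode_eventually _ _ (removeF_eventually _))

/-- `χ_i(z)`. -/
def chi (i : Fin n) : FockField n :=
  ofModes (freeMode (createF (.chi i)) (removeF (.psi i)))
    (freeMode_eventually _ _ (removeF_eventually _))

/-- The ghost `b_a(z)`, with `b_a(z) c^b(0) ∼ δ_a^b / z`. -/
def b (a : Fin (n - 1)) : FockField n :=
  ofModes (freeMode (createF (.b a)) (removeF (.c a)))
    (freeMode_eventually _ _ (removeF_eventually _))

/-- The ghost `c^a(z)`. -/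
def c (a : Fin (n - 1)) : FockField n :=
  ofModes (freeMode (createF (.c a)) (removeF (.b a)))
    (freeMode_eventually _ _ (removeF_eventually _))

/-- The derivative `∂A(z)`, with modes `(∂A)_{(m)} = -m A_{(m-1)}`. -/
def der (A : FockField n) : FockField n :=
  ofModes (fun m => (-(m : ℂ)) • VertexOperator.ncoeff A (m - 1)) (fun v => by
    obtain ⟨N, hN⟩ := ncoeff_eventually A v
    refine ⟨N + 1, fun m hm => ?_⟩
    rw [LinearMap.smul_apply, hN (m - 1) (by omega), smul_zero])

/-! ### Products of fields -/

/-- The bilinear operation that equals `(-1)^{|x||y|} y x` when `x` and `y` are homogeneous: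
it is `y x₀ + (γ y γ) x₁`, where `γ` is the parity involution and `x₀ = (x + γ x γ) / 2`,
`x₁ = (x - γ x γ) / 2` are the even and the odd part of `x`. -/
def signedSwap (x y : Module.End ℂ (Fock n)) : Module.End ℂ (Fock n) :=
  y * ((1 / 2 : ℂ) • (x + parity * x * parity)) +
    (parity * y * parity) * ((1 / 2 : ℂ) • (x - parity * x * parity))

/-- The `j`-th term of the mode `(A_{(p)} B)_{(m)}`. -/
def prodTerm (A : FockField n) (p : ℤ) (B : FockField n) (m : ℤ) (j : ℕ) :
    Module.End ℂ (Fock n) :=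
  ((-1 : ℂ) ^ j * ((Ring.choose p j : ℤ) : ℂ)) •
    (VertexOperator.ncoeff A (p - j) * VertexOperator.ncoeff B (m + j) -
      (-1 : ℂ) ^ p •
        signedSwap (VertexOperator.ncoeff A j) (VertexOperator.ncoeff B (p + m - j)))

theorem prodTerm_bound (A : FockField n) (p : ℤ) (B : FockField n) (v : Fock n) :
    ∃ (J : ℕ) (M : ℤ), (∀ m, ∀ j : ℕ, J ≤ j → M ≤ m + j → prodTerm A p B m j v = 0) ∧
      (∀ m ≥ M, ∀ j, prodTerm A p B m j v = 0) := by
  obtain ⟨N₁, h₁⟩ := ncoeff_eventually A v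
  obtain ⟨N₂, h₂⟩ := ncoeff_eventually A (parity v)
  obtain ⟨N₃, h₃⟩ := ncoeff_eventually B v
  have hswap : ∀ m : ℤ, ∀ j : ℕ, N₁ ≤ j → N₂ ≤ j →
      signedSwap (VertexOperator.ncoeff A j) (VertexOperator.ncoeff B (p + m - j)) v = 0 := by
    intro m j hj₁ hj₂
    simp [signedSwap, h₁ j hj₁, h₂ j hj₂]
  set J : ℕ := (max N₁ N₂).toNat with hJ
  have hJ₁ : N₁ ≤ J := by omega
  have hJ₂ : N₂ ≤ J := by omega
  -- uniform bound for the finitely many remaining second terms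
  have hfin : ∃ K : ℤ, ∀ m ≥ K, ∀ j < J,
      signedSwap (VertexOperator.ncoeff A j) (VertexOperator.ncoeff B (p + m - j)) v = 0 := by
    have hall : ∀ j : ℕ, ∃ K : ℤ, ∀ m ≥ K,
        signedSwap (VertexOperator.ncoeff A j) (VertexOperator.ncoeff B (p + m - j)) v = 0 := by
      intro j
      obtain ⟨K₁, k₁⟩ := ncoeff_eventually B (VertexOperator.ncoeff A j v)
      obtain ⟨K₂, k₂⟩ := ncoeff_eventually B (parity (VertexOperator.ncoeff A j (parity v)))
      obtain ⟨K₃, k₃⟩ := ncoeff_eventually B (parity (VertexOperator.ncoeff A j v))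
      obtain ⟨K₄, k₄⟩ :=
        ncoeff_eventually B (parity (parity (VertexOperator.ncoeff A j (parity v))))
      refine ⟨max (max K₁ K₂) (max K₃ K₄) - p + j, fun m hm => ?_⟩
      simp [signedSwap, k₁ (p + m - j) (by omega), k₂ (p + m - j) (by omega),
        k₃ (p + m - j) (by omega), k₄ (p + m - j) (by omega)]
    choose K hK using hall
    refine ⟨∑ j ∈ Finset.range J, |K j|, fun m hm j hj => hK j m ?_⟩
    have h5 : |K j| ≤ ∑ j ∈ Finset.range J, |K j| :=
      Finset.single_le_sum (f := fun j => |K j|) (fun _ _ => abs_nonneg _)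
        (Finset.mem_range.2 hj)
    exact le_trans (le_abs_self _) (le_trans h5 hm)
  obtain ⟨K, hK⟩ := hfin
  refine ⟨J, max N₃ K, fun m j hj hm => ?_, fun m hm j => ?_⟩
  · simp [prodTerm, h₃ (m + j) (by omega), hswap m j (by omega) (by omega)]
  · have h6 : signedSwap (VertexOperator.ncoeff A j) (VertexOperator.ncoeff B (p + m - j)) v
        = 0 := by
      rcases lt_or_ge j J with hj | hj
      · exact hK m (by omega) j hj
      · exact hswap m j (by omega) (by omega)
    simp [prodTerm, h₃ (m + j) (by omega), h6]

theorem prodTerm_finite (A : FockField n) (p : ℤ) (B : FockField n) (m : ℤ) (v : Fock n) :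
    (Function.support fun j => prodTerm A p B m j v).Finite := by
  obtain ⟨J, M, h, -⟩ := prodTerm_bound A p B v
  refine (Set.finite_lt_nat (max J (M - m).toNat)).subset fun j hj => ?_
  by_contra hlt
  have hlt' : max J (M - m).toNat ≤ j := not_lt.1 hlt
  exact hj (h m j (by omega) (by omega))

/-- The mode
`(A_{(p)} B)_{(m)} = ∑_{j ≥ 0} (-1)^j (p choose j)
  (A_{(p-j)} B_{(m+j)} - (-1)^{p + |A||B|} B_{(p+m-j)} A_{(j)})`,
a finite sum on every vector. -/
def prodMode (A : FockField n) (p : ℤ) (B : FockField n) (m : ℤ) : Module.End ℂ (Fock n) where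
  toFun v := ∑ᶠ j : ℕ, prodTerm A p B m j v
  map_add' v w := by
    simp only [map_add]
    exact finsum_add_distrib (prodTerm_finite A p B m v) (prodTerm_finite A p B m w)
  map_smul' r v := by
    simp only [map_smul, RingHom.id_apply]
    exact (smul_finsum' r (prodTerm_finite A p B m v)).symm

/-- The product `(A_{(p)} B)(w) = ∮ dz/(2πi) (z - w)^p A(z) B(w)` of fields (radially ordered
contour integral around `w`). -/
def prod (A : FockField n) (p : ℤ) (B : FockField n) : FockField n :=
  ofModes (prodMode A p B) (fun v => by
    obtain ⟨-, M, -, h⟩ := prodTerm_bound A p B v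
    refine ⟨M, fun m hm => ?_⟩
    change (∑ᶠ j : ℕ, prodTerm A p B m j v) = 0
    simp [h m hm])

/-- The normally ordered product `(AB)_0`, the coefficient of `(z - w)^0` in `A(z) B(w)`. Longer
products are nested to the right, `ABC = A(BC)`. -/
def nop (A B : FockField n) : FockField n := prod A (-1) B

/-- The vertex algebra generated by a set `S` of fields: the smallest linear space of fields that
contains `S` and the identity field and is closed under all the products `A_{(p)} B`, `p ∈ ℤ`
(hence under `∂A = A_{(-2)} 1`). -/
def generatedBy (S : Set (FockField n)) : Submodule ℂ (FockField n) :=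
  sInf {M | one ∈ M ∧ S ⊆ M ∧ ∀ A ∈ M, ∀ B ∈ M, ∀ p : ℤ, prod A p B ∈ M}

/-- The vertex algebra of the symplectic bosons, the fermi multiplets and the ghosts. -/
def fullAlgebra (n : ℕ) : Submodule ℂ (FockField n) :=
  generatedBy (Set.range X ∪ Set.range Y ∪ Set.range psi ∪ Set.range chi ∪ Set.range b ∪
    Set.range c)

/-! ### BRST reduction -/

/-- The `a`-th index among the `n` flavours, for `a = 1, …, n - 1`. -/
def node (a : Fin (n - 1)) : Fin n := ⟨a, by omega⟩

/-- The index `a + 1` among the `n` flavours, for `a = 1, …, n - 1`. -/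
def nodeSucc (a : Fin (n - 1)) : Fin n := ⟨a + 1, by omega⟩

/-- `J_BRST = ∑_a c^a (X_a Y_a - X_{a+1} Y_{a+1} + ψ_a χ_a - ψ_{a+1} χ_{a+1})`. -/
def currentBRST (n : ℕ) : FockField n :=
  ∑ a : Fin (n - 1), nop (c a)
    (nop (X (node a)) (Y (node a)) - nop (X (nodeSucc a)) (Y (nodeSucc a)) +
      nop (psi (node a)) (chi (node a)) - nop (psi (nodeSucc a)) (chi (nodeSucc a)))

/-- The action `A ↦ Q A = ∮ dz/(2πi) J_BRST(z) A(w)` of the BRST charge on fields; its modes are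
the supercommutators of `Q = (J_BRST)_{(0)}` with the modes of `A`. -/
def Q (A : FockField n) : FockField n := prod (currentBRST n) 0 A

/-- `A ≡ B`: the difference `A - B` is `Q`-exact. -/
def BRSTEquiv (A B : FockField n) : Prop := ∃ C ∈ fullAlgebra n, A - B = Q C

/-! ### The operators -/

/-- `𝒜_i = -X_i Y_i`. -/
def calA (i : Fin n) : FockField n := -nop (X i) (Y i)

/-- `Â_i 𝒪 = (𝒜_i 𝒪)_0`. -/
def hatA (i : Fin n) (O : FockField n) : FockField n := nop (calA i) O

/-- `𝒟_i 𝒪 = (𝒜_i 𝒪)_0 + (X_i (Y_i 𝒪)_0)_0`. -/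
def calD (i : Fin n) (O : FockField n) : FockField n := nop (calA i) O + nop (X i) (nop (Y i) O)

/-- `T_i = (1/2) (𝒟_i + Â_i) 𝒜_i`. -/
def T (i : Fin n) : FockField n := (1 / 2 : ℂ) • (calD i (calA i) + hatA i (calA i))

/-- `W_i = (1/3) √(2/3) {𝒟_i 𝒟_i 𝒜_i + (1/2) 𝒟_i Â_i 𝒜_i + (1/2) Â_i 𝒟_i 𝒜_i + Â_i Â_i 𝒜_i}`. -/
def W (i : Fin n) : FockField n :=
  ((1 / 3 : ℂ) * (Real.sqrt (2 / 3) : ℂ)) •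
    (calD i (calD i (calA i)) + (1 / 2 : ℂ) • calD i (hatA i (calA i)) +
      (1 / 2 : ℂ) • hatA i (calD i (calA i)) + hatA i (hatA i (calA i)))

/-- `U = -(1/n) ∑_i X_i Y_i`. -/
def U (n : ℕ) : FockField n := (-(1 / (n : ℂ))) • ∑ i : Fin n, nop (X i) (Y i)

/-- `U_F = -(1/n) ∑_i ψ_i χ_i`. -/
def UF (n : ℕ) : FockField n := (-(1 / (n : ℂ))) • ∑ i : Fin n, nop (psi i) (chi i)

/-- `M_i^+ = X_i ψ_i`. -/
def Mplus (i : Fin n) : FockField n := nop (X i) (psi i)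

/-- `M_i^- = Y_i χ_i`. -/
def Mminus (i : Fin n) : FockField n := nop (Y i) (chi i)

/-- `[A, B] = (AB)_0 - (BA)_0`, the commutator for the normally ordered product. -/
def nopComm (A B : FockField n) : FockField n := nop A B - nop B A

end BoundaryVOA

end

open BoundaryVOA (W T U UF Mplus Mminus nop der nopComm Q BRSTEquiv generatedBy)

open scoped TensorProduct

noncomputable section

namespace BoundaryVOA

variable {n : ℕ}

open VertexOperator (ncoeff)

/-! ### Modes and parity -/

/-! Write `J_i = X_i Y_i + ψ_i χ_i` (`current i`). The argument has two independent halves: an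
identity in the vertex superalgebra itself, and a comparison in cohomology.

The identity (`T_eq`, `W_eq`) says that `T_i` and `W_i` equal the asserted expressions exactly when
`U + U_F` is replaced by `-J_i`; no exact terms are needed. To prove it, left multiplications `B ↦
A_{(p)} B` are treated as operators on the space of fields. If the modes of `a` and `φ` satisfy
`a_{(k)} φ_{(l)} = ± φ_{(l)} a_{(k)} + ρ_{(k+l)}`, these operators satisfy the same relation with
residue `ρ_{(p+q)}` (`prod_prod`). This is a direct computation with double sums and
Chu–Vandermonde, and it asks nothing of the field `B` acted on. All relevant operator products (of
the free fields, and of their bilinears with the free fields) have at most a simple pole. Hence the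
creation operators of `X, Y, ψ, χ` supercommute, the bilinears move past them with explicit
corrections, and `one` serves as vacuum (`creationRelations`). Both sides then become combinations
of ordered words in creation operators on the vacuum, and comparing coefficients finishes
(`CreationRelations.quadratic`, `CreationRelations.cubic`).

In cohomology, `Q b_a = J_a - J_{a+1}` (`Q_b`), so all `J_i` are equivalent to one another and
therefore to their average, which is `-(U + U_F)` (`neg_current_equiv`). The fields `J_i` and
`M_i^±` are closed: each `M_i^±` is gauge invariant with no central term, and the Schwinger terms of
bosons and fermions in `J_i` cancel. Since `Q` is an odd derivation of every product
(`prod_zero_prod`), products and derivatives descend to cohomology (`BRSTEquiv.prod`,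
`BRSTEquiv.der`), and `-J_i` may be replaced by `U + U_F` in both expressions.

For the generation statement, the even closed fields that are represented in the target subalgebra
form a subspace stable under all products and containing `T_i` and `W_i`, hence containing all that
these generate. -/

theorem field_ext {A B : FockField n} (h : ∀ m : ℤ, (ncoeff A m) = (ncoeff B m)) : A = B := by
  apply HVertexOperator.coeff_inj
  funext k
  simpa using h (-k - 1)

theorem ncoeff_one (m : ℤ) : ncoeff (one : FockField n) m = if m = -1 then 1 else 0 :=
  ncoeff_ofModes _ _ m

theorem ncoeff_der (A : FockField n) (m : ℤ) : ncoeff (der A) m = (-(m : ℂ)) • (ncoeff A (m - 1)) :=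
  ncoeff_ofModes _ _ m

theorem ncoeff_prod (A : FockField n) (p : ℤ) (B : FockField n) (m : ℤ) :
    ncoeff (prod A p B) m = prodMode A p B m :=
  ncoeff_ofModes _ _ m

theorem prodMode_apply (A : FockField n) (p : ℤ) (B : FockField n) (m : ℤ) (v : Fock n) :
    prodMode A p B m v = ∑ᶠ j : ℕ, prodTerm A p B m j v := rfl

theorem parity_mul_self : (parity : Module.End ℂ (Fock n)) * parity = 1 := by
  rw [parity, Module.End.mul_eq_comp, ← LinearEquiv.conj_comp, ← LinearMap.lTensor_comp,
    ← AlgHom.comp_toLinearMap, CliffordAlgebra.involute_comp_involute]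
  simp [Module.End.one_eq_id]

theorem parity_pow_mul_self (e : ℕ) : (parity : Module.End ℂ (Fock n)) ^ e * parity ^ e = 1 := by
  rw [← (Commute.refl _).mul_pow, parity_mul_self, one_pow]

/-- Conjugation by the `e`-th power of the parity involution. -/
def twist (e : ℕ) : Module.End ℂ (Fock n) →ₗ[ℂ] Module.End ℂ (Fock n) :=
  (LinearMap.mulLeft ℂ (parity ^ e)).comp (LinearMap.mulRight ℂ (parity ^ e))

theorem twist_apply (e : ℕ) (x : Module.End ℂ (Fock n)) :
    twist e x = parity ^ e * x * parity ^ e := by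
  simp [twist, mul_assoc]

theorem twist_mul (e : ℕ) (x y : Module.End ℂ (Fock n)) :
    twist e (x * y) = twist e x * twist e y := by
  simp only [twist_apply]
  calc _ = parity ^ e * x * 1 * y * parity ^ e := by simp [mul_assoc]
    _ = _ := by rw [← parity_pow_mul_self e]; simp only [mul_assoc]

theorem twist_twist (e f : ℕ) (x : Module.End ℂ (Fock n)) :
    twist e (twist f x) = twist (e + f) x := by
  simp only [twist_apply, mul_assoc, pow_add, ← pow_mul_comm]

theorem twist_zero (x : Module.End ℂ (Fock n)) : twist 0 x = x := by
  simp [twist_apply]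

theorem twist_two_mul (e : ℕ) (x : Module.End ℂ (Fock n)) : twist (2 * e) x = x := by
  have h : (parity : Module.End ℂ (Fock n)) ^ (2 * e) = 1 := by
    rw [pow_mul, pow_two, parity_mul_self, one_pow]
  simp [twist_apply, h]

/-- The field `A` has parity `e` modulo `2`. -/
def Homog (e : ℕ) (A : FockField n) : Prop := ∀ m : ℤ, twist 1 (ncoeff A m) = (-1 : ℂ) ^ e • (ncoeff A m)

theorem Homog.twist {e : ℕ} {A : FockField n} (h : Homog e A) (f : ℕ) (m : ℤ) :
    twist f (ncoeff A m) = (-1 : ℂ) ^ (f * e) • (ncoeff A m) := by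
  induction f with
  | zero => simp [twist_zero]
  | succ k ih =>
    rw [add_comm k 1, ← twist_twist, ih, map_smul, h m, smul_smul]
    congr 1
    ring

/-- Only one of the two halves of the swap survives for a homogeneous first argument. The Koszul
sign then takes the form of a conjugation of `y`, which makes sense with no parity assumption on
`y`; this is why the second factor of a product can stay arbitrary below. -/
theorem Homog.signedSwap {e : ℕ} {A : FockField n} (h : Homog e A) (m : ℤ)
    (y : Module.End ℂ (Fock n)) : signedSwap (ncoeff A m) y = BoundaryVOA.twist e y * (ncoeff A m) := by
  have h1 : parity * (ncoeff A m) * parity = (-1 : ℂ) ^ e • (ncoeff A m) := by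
    simpa [twist_apply] using h m
  rw [BoundaryVOA.signedSwap, h1]
  rcases Nat.even_or_odd' e with ⟨k, rfl | rfl⟩
  · rw [twist_two_mul, pow_mul]
    simp only [even_two, Even.neg_pow, one_pow, one_smul, sub_self, smul_zero, mul_zero, add_zero]
    rw [← two_smul ℂ (ncoeff A m), smul_smul]
    norm_num
  · rw [add_comm (2 * k) 1, ← twist_twist, twist_two_mul, pow_add, pow_mul, twist_apply]
    simp only [even_two, Even.neg_pow, one_pow, mul_one, pow_one, neg_smul, one_smul,
      sub_neg_eq_add, add_neg_cancel, smul_zero, mul_zero, zero_add]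
    rw [← two_smul ℂ (ncoeff A m), smul_smul]
    norm_num

/-- The coefficients `(-1)^j (p choose j)`. -/
def binCoeff (p : ℤ) (j : ℕ) : ℂ := (-1 : ℂ) ^ j * ((Ring.choose p j : ℤ) : ℂ)

theorem Homog.prodTerm {e : ℕ} {A : FockField n} (h : Homog e A) (p : ℤ) (B : FockField n)
    (m : ℤ) (j : ℕ) :
    prodTerm A p B m j = binCoeff p j • ((ncoeff A (p - j)) * (ncoeff B (m + j)) -
      (-1 : ℂ) ^ p • (BoundaryVOA.twist e (ncoeff B (p + m - j)) * (ncoeff A ((j : ℤ))))) := by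
  rw [BoundaryVOA.prodTerm, h.signedSwap, binCoeff]

theorem twist_eventually (e : ℕ) (A : FockField n) (v : Fock n) :
    ∃ N : ℤ, ∀ m ≥ N, twist e (ncoeff A m) v = 0 := by
  obtain ⟨N, hN⟩ := ncoeff_eventually A ((parity ^ e : Module.End ℂ (Fock n)) v)
  refine ⟨N, fun m hm => ?_⟩
  rw [twist_apply, Module.End.mul_apply, Module.End.mul_apply, hN m hm, map_zero]

theorem twist_prodMode_apply (e : ℕ) (A : FockField n) (p : ℤ) (B : FockField n) (m : ℤ)
    (v : Fock n) :
    twist e (prodMode A p B m) v = ∑ᶠ j : ℕ, twist e (prodTerm A p B m j) v := by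
  simp only [twist_apply, Module.End.mul_apply, prodMode_apply]
  exact map_finsum _ (prodTerm_finite A p B m _)

theorem binCoeff_neg_one (j : ℕ) : binCoeff (-1) j = 1 := by
  have h : Ring.choose (-1 : ℤ) j = (-1) ^ j := by
    rw [Ring.choose_neg, add_sub_cancel_left, Ring.choose_natCast, Nat.choose_self]
    simp [Int.negOnePow_def, Units.smul_def]
  rw [binCoeff, h]
  push_cast
  rw [← mul_pow]
  simp

/-- Chu–Vandermonde: `binCoeff p j` is the coefficient of `t^j` in `(1 - t)^p`. It collapses the
double sum in `prod_prod` to the single sum defining a product of index `p + q`. -/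
theorem sum_binCoeff_mul (p q : ℤ) (l : ℕ) :
    ∑ ij ∈ Finset.HasAntidiagonal.antidiagonal l, binCoeff p ij.1 * binCoeff q ij.2 = binCoeff (p + q) l := by
  simp only [binCoeff]
  rw [Ring.add_choose_eq l (Commute.all p q)]
  push_cast
  rw [Finset.mul_sum]
  refine Finset.sum_congr rfl fun ij hij => ?_
  rw [← Finset.HasAntidiagonal.mem_antidiagonal.1 hij, pow_add]
  ring

/-! ### The action of modes on fields -/

/-- The asymmetric hypotheses match what nested modes provide: a cutoff for the mode acting first
that depends only on `v`, and then, for each of its finitely many values, a cutoff for the next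
mode. -/
theorem finite_support_of_bounds {V : Type*} [Zero V] (g : ℕ × ℕ → V)
    (h₁ : ∃ N, ∀ j ≥ N, ∀ i, g (i, j) = 0) (h₂ : ∀ j, ∃ N, ∀ i ≥ N, g (i, j) = 0) :
    (Function.support g).Finite := by
  obtain ⟨N, hN⟩ := h₁
  choose M hM using h₂
  refine ((Set.finite_lt_nat N).biUnion fun j _ =>
    (Set.finite_lt_nat (M j)).image fun i => (i, j)).subset ?_
  rintro ⟨i, j⟩ hij
  have hj : j < N := by
    by_contra h
    exact hij (hN j (not_lt.1 h) i)
  have hi : i < M j := by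
    by_contra h
    exact hij (hM j i (not_lt.1 h))
  exact Set.mem_biUnion (s := {j | j < N}) hj ⟨i, hi, rfl⟩

theorem finite_support_map {ι : Type*} {g : ι → Fock n} (h : (Function.support g).Finite)
    (L : Module.End ℂ (Fock n)) : (Function.support fun i => L (g i)).Finite :=
  h.subset fun i hi hg => hi (by simp only [hg, map_zero])

theorem finite_support_swap {V : Type*} [Zero V] (g : ℕ × ℕ → V)
    (h : (Function.support fun ij : ℕ × ℕ => g ij.swap).Finite) :
    (Function.support g).Finite := by
  refine (h.image Prod.swap).subset fun ij hij => ⟨ij.swap, ?_, Prod.swap_swap ij⟩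
  simpa using hij

/-- The contribution of `a_{(p-i)}`, `a_{(i)}` and `φ_{(q-j)}`, `φ_{(j)}` to the modes of
`a_{(p)} (φ_{(q)} B)`. -/
def nestedTerm (e : ℕ) (a : FockField n) (p : ℤ) (f : ℕ) (φ : FockField n) (q : ℤ)
    (B : FockField n) (m : ℤ) (v : Fock n) (ij : ℕ × ℕ) : Fock n :=
  (binCoeff p ij.1 * binCoeff q ij.2) •
    (ncoeff a (p - ij.1) (ncoeff φ (q - ij.2) (ncoeff B (m + ij.1 + ij.2) v)) -
      (-1 : ℂ) ^ q • ncoeff a (p - ij.1) (twist f (ncoeff B (q + m + ij.1 - ij.2))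
        (ncoeff φ ij.2 v)) -
      ((-1 : ℂ) ^ p * (-1 : ℂ) ^ (e * f)) • ncoeff φ (q - ij.2)
        (twist e (ncoeff B (p + m - ij.1 + ij.2)) (ncoeff a ij.1 v)) +
      ((-1 : ℂ) ^ p * (-1 : ℂ) ^ q * (-1 : ℂ) ^ (e * f)) •
        twist (e + f) (ncoeff B (p + q + m - ij.1 - ij.2)) (ncoeff φ ij.2 (ncoeff a ij.1 v)))

theorem nestedTerm_finite (e : ℕ) (a : FockField n) (p : ℤ) (f : ℕ) (φ : FockField n) (q : ℤ)
    (B : FockField n) (m : ℤ) (v : Fock n) :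
    (Function.support (nestedTerm e a p f φ q B m v)).Finite := by
  have h1 : (Function.support fun ij : ℕ × ℕ =>
      ncoeff a (p - ij.1) (ncoeff φ (q - ij.2) (ncoeff B (m + ij.1 + ij.2) v))).Finite := by
    obtain ⟨N, hN⟩ := ncoeff_eventually B v
    refine finite_support_of_bounds _ ⟨(N - m).toNat, fun j hj i => ?_⟩
      fun j => ⟨(N - m).toNat, fun i hi => ?_⟩
    all_goals simp only [hN (m + i + j) (by omega), map_zero]
  have h2 : (Function.support fun ij : ℕ × ℕ =>
      ncoeff a (p - ij.1) (twist f (ncoeff B (q + m + ij.1 - ij.2))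
        (ncoeff φ ij.2 v))).Finite := by
    refine finite_support_of_bounds _ ?_ fun j => ?_
    · obtain ⟨N, hN⟩ := ncoeff_eventually φ v
      exact ⟨N.toNat, fun j hj i => by simp only [hN j (by omega), map_zero]⟩
    · obtain ⟨N, hN⟩ := twist_eventually f B (ncoeff φ j v)
      exact ⟨(N - q - m + j).toNat, fun i hi => by
        simp only [hN (q + m + i - j) (by omega), map_zero]⟩
  have h3 : (Function.support fun ij : ℕ × ℕ => ncoeff φ (q - ij.2)
      (twist e (ncoeff B (p + m - ij.1 + ij.2)) (ncoeff a ij.1 v))).Finite := by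
    refine finite_support_swap _ (finite_support_of_bounds _ ?_ fun i => ?_)
    · obtain ⟨N, hN⟩ := ncoeff_eventually a v
      exact ⟨N.toNat, fun i hi j => by
        simp only [Prod.fst_swap, Prod.snd_swap, hN i (by omega), map_zero]⟩
    · obtain ⟨N, hN⟩ := twist_eventually e B (ncoeff a i v)
      exact ⟨(N - p - m + i).toNat, fun j hj => by
        simp only [Prod.fst_swap, Prod.snd_swap, hN (p + m - i + j) (by omega), map_zero]⟩
  have h4 : (Function.support fun ij : ℕ × ℕ =>
      twist (e + f) (ncoeff B (p + q + m - ij.1 - ij.2))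
        (ncoeff φ ij.2 (ncoeff a ij.1 v))).Finite := by
    refine finite_support_swap _ (finite_support_of_bounds _ ?_ fun i => ?_)
    · obtain ⟨N, hN⟩ := ncoeff_eventually a v
      exact ⟨N.toNat, fun i hi j => by
        simp only [Prod.fst_swap, Prod.snd_swap, hN i (by omega), map_zero]⟩
    · obtain ⟨N, hN⟩ := ncoeff_eventually φ (ncoeff a i v)
      exact ⟨N.toNat, fun j hj => by
        simp only [Prod.fst_swap, Prod.snd_swap, hN j (by omega), map_zero]⟩
  refine ((h1.union h2).union (h3.union h4)).subset fun ij hij => ?_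
  contrapose! hij
  simp only [Set.mem_union, Function.mem_support, not_or, not_not] at hij ⊢
  obtain ⟨⟨k1, k2⟩, k3, k4⟩ := hij
  rw [nestedTerm, k1, k2, k3, k4]
  simp

theorem prod_prod_apply {e f : ℕ} {a φ : FockField n} (ha : Homog e a) (hφ : Homog f φ)
    (p q : ℤ) (B : FockField n) (m : ℤ) (v : Fock n) :
    ncoeff (prod a p (prod φ q B)) m v = ∑ᶠ ij : ℕ × ℕ, nestedTerm e a p f φ q B m v ij := by
  rw [finsum_curry _ (nestedTerm_finite e a p f φ q B m v), ncoeff_prod, prodMode_apply]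
  refine finsum_congr fun i => ?_
  have hfin₁ := finite_support_map (prodTerm_finite φ q B (m + i) v) (ncoeff a (p - i))
  have hfin₂ : (Function.support fun j =>
      twist e (prodTerm φ q B (p + m - i) j) (ncoeff a i v)).Finite := by
    simp only [twist_apply, Module.End.mul_apply]
    exact finite_support_map (prodTerm_finite φ q B (p + m - i) _) _
  have hfin₃ := finite_support_map hfin₂ ((-1 : ℂ) ^ p • (1 : Module.End ℂ (Fock n)))
  -- Conjugating the inner product by the `e`-th parity power gives `φ` the sign `(-1)^(e * f)` and
  -- accumulates the twists on `B` to `e + f`.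
  have hterm : ∀ j : ℕ, nestedTerm e a p f φ q B m v (i, j) = (binCoeff p i •
      (1 : Module.End ℂ (Fock n))) (ncoeff a (p - i) (prodTerm φ q B (m + i) j v) -
        ((-1 : ℂ) ^ p • (1 : Module.End ℂ (Fock n)))
          (twist e (prodTerm φ q B (p + m - i) j) (ncoeff a i v))) := by
    intro j
    simp only [hφ.prodTerm, nestedTerm, map_smul, map_sub, twist_mul, twist_twist, hφ.twist,
      LinearMap.smul_apply, LinearMap.sub_apply, Module.End.mul_apply, Module.End.one_apply]
    rw [show q + (p + m - (i : ℤ)) - j = p + q + m - i - j by ring,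
      show q + (m + (i : ℤ)) - j = q + m + i - j by ring]
    module
  rw [finsum_congr hterm, ← map_finsum (binCoeff p i • (1 : Module.End ℂ (Fock n)))
    ((hfin₁.union hfin₃).subset (Function.support_sub _ _)), finsum_sub_distrib hfin₁ hfin₃,
    ← map_finsum _ (prodTerm_finite φ q B (m + i) v), ← map_finsum _ hfin₂, ha.prodTerm,
    ncoeff_prod, ncoeff_prod, ← twist_prodMode_apply, ← prodMode_apply]
  simp

theorem finsum_antidiagonal {V : Type*} [AddCommMonoid V] (g : ℕ × ℕ → V)
    (hg : (Function.support g).Finite) :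
    ∑ᶠ ij, g ij = ∑ᶠ l : ℕ, ∑ ij ∈ Finset.HasAntidiagonal.antidiagonal l, g ij := by
  classical
  have hsub : Function.support (fun l : ℕ => ∑ ij ∈ Finset.HasAntidiagonal.antidiagonal l, g ij) ⊆
      (hg.toFinset.image fun ij => ij.1 + ij.2 : Finset ℕ) := by
    intro l hl
    obtain ⟨ij, hij, hne⟩ := Finset.exists_ne_zero_of_sum_ne_zero hl
    simp only [Finset.coe_image, Set.mem_image, Finset.mem_coe, Set.Finite.mem_toFinset]
    exact ⟨ij, hne, Finset.HasAntidiagonal.mem_antidiagonal.1 hij⟩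
  rw [finsum_eq_sum_of_support_subset _ hsub, finsum_eq_sum g hg,
    ← Finset.sum_fiberwise_of_maps_to (t := hg.toFinset.image fun ij => ij.1 + ij.2)
      (g := fun ij => ij.1 + ij.2) (fun ij h => Finset.mem_image_of_mem _ h)]
  refine Finset.sum_congr rfl fun l _ => ?_
  refine Finset.sum_subset (fun ij h => ?_) fun ij h₁ h₂ => ?_
  · exact Finset.HasAntidiagonal.mem_antidiagonal.2 (Finset.mem_filter.1 h).2
  · simp only [Finset.HasAntidiagonal.mem_antidiagonal, Finset.mem_filter,
      Set.Finite.mem_toFinset, Function.mem_support] at h₁ h₂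
    by_contra hne
    exact h₂ ⟨hne, h₁⟩

/-- If the modes of `a` and `φ` satisfy `a_{(k)} φ_{(l)} = ± φ_{(l)} a_{(k)} + ρ_{(k+l)}`, so do
their actions on fields by products. -/
theorem prod_prod {e f : ℕ} {a φ ρ : FockField n} (ha : Homog e a) (hφ : Homog f φ)
    (hρ : Homog (e + f) ρ)
    (h : ∀ k l : ℤ, ncoeff a k * ncoeff φ l =
      (-1 : ℂ) ^ (e * f) • (ncoeff φ l * ncoeff a k) + ncoeff ρ (k + l))
    (p q : ℤ) (B : FockField n) :
    prod a p (prod φ q B) = (-1 : ℂ) ^ (e * f) • prod φ q (prod a p B) + prod ρ (p + q) B := by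
  have hsq : ((-1 : ℂ) ^ (e * f)) * (-1) ^ (e * f) = 1 := by rw [← mul_pow]; simp
  have h' : ∀ k l u, ncoeff a k (ncoeff φ l u) =
      (-1 : ℂ) ^ (e * f) • ncoeff φ l (ncoeff a k u) + ncoeff ρ (k + l) u := fun k l u => by
    simpa using LinearMap.congr_fun (h k l) u
  refine field_ext fun m => LinearMap.ext fun v => ?_
  have hswap : ncoeff (prod φ q (prod a p B)) m v =
      ∑ᶠ ij : ℕ × ℕ, nestedTerm f φ q e a p B m v ij.swap := by
    rw [prod_prod_apply hφ ha]
    exact (finsum_comp_equiv (Equiv.prodComm ℕ ℕ)).symm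
  have hfin₁ := nestedTerm_finite e a p f φ q B m v
  have hfin₂ : (Function.support fun ij : ℕ × ℕ =>
      (((-1 : ℂ) ^ (e * f)) • (1 : Module.End ℂ (Fock n)))
        (nestedTerm f φ q e a p B m v ij.swap)).Finite :=
    finite_support_map (finite_support_swap _
      (by simpa using nestedTerm_finite f φ q e a p B m v)) _
  -- The terms with `B` between `a` and `φ` cancel without any relation. In the other two, `a` and
  -- `φ` are adjacent and the mode relation leaves `ρ`; apart from the binomials, the result depends
  -- on `i + j` only.
  have hdiff : ∀ ij : ℕ × ℕ, nestedTerm e a p f φ q B m v ij -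
      (((-1 : ℂ) ^ (e * f)) • (1 : Module.End ℂ (Fock n)))
        (nestedTerm f φ q e a p B m v ij.swap) =
      (binCoeff p ij.1 * binCoeff q ij.2) •
        (ncoeff ρ (p + q - (ij.1 + ij.2 : ℕ)) (ncoeff B (m + (ij.1 + ij.2 : ℕ)) v) -
          (-1 : ℂ) ^ (p + q) • twist (e + f) (ncoeff B (p + q + m - (ij.1 + ij.2 : ℕ)))
            (ncoeff ρ (ij.1 + ij.2 : ℕ) v)) := by
    rintro ⟨i, j⟩
    simp only [nestedTerm, Prod.swap, LinearMap.smul_apply, Module.End.one_apply, h', map_add,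
      map_smul, mul_comm f e, add_comm f e]
    rw [show m + (j : ℤ) + i = m + i + j by ring, show p + m + (j : ℤ) - i = p + m - i + j by ring,
      show q + m - (j : ℤ) + i = q + m + i - j by ring,
      show q + p + m - (j : ℤ) - i = p + q + m - i - j by ring, zpow_add₀ (by norm_num)]
    rw [show p - (i : ℤ) + (q - j) = p + q - (i + j : ℕ) by push_cast; ring,
      show m + (i : ℤ) + j = m + (i + j : ℕ) by push_cast; ring,
      show p + q + m - (i : ℤ) - j = p + q + m - (i + j : ℕ) by push_cast; ring,
      show (i : ℤ) + j = (i + j : ℕ) by push_cast; ring]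
    rcases neg_one_pow_eq_or ℂ (e * f) with hs | hs <;> rw [hs] <;> module
  have hfin : (Function.support fun ij : ℕ × ℕ => (binCoeff p ij.1 * binCoeff q ij.2) •
        (ncoeff ρ (p + q - (ij.1 + ij.2 : ℕ)) (ncoeff B (m + (ij.1 + ij.2 : ℕ)) v) -
          (-1 : ℂ) ^ (p + q) • twist (e + f) (ncoeff B (p + q + m - (ij.1 + ij.2 : ℕ)))
            (ncoeff ρ (ij.1 + ij.2 : ℕ) v))).Finite := by
    rw [← funext hdiff]
    exact (hfin₁.union hfin₂).subset (Function.support_sub _ _)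
  rw [map_add, map_smul, Pi.add_apply, Pi.smul_apply, LinearMap.add_apply, LinearMap.smul_apply,
    hswap, prod_prod_apply ha hφ, ← sub_eq_iff_eq_add']
  have hlin : (-1 : ℂ) ^ (e * f) • ∑ᶠ ij : ℕ × ℕ, nestedTerm f φ q e a p B m v ij.swap =
      ∑ᶠ ij : ℕ × ℕ, (((-1 : ℂ) ^ (e * f)) • (1 : Module.End ℂ (Fock n)))
        (nestedTerm f φ q e a p B m v ij.swap) := by
    rw [← map_finsum _ (finite_support_swap _
      (by simpa using nestedTerm_finite f φ q e a p B m v))]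
    rfl
  rw [hlin, ← finsum_sub_distrib hfin₁ hfin₂, finsum_congr hdiff, finsum_antidiagonal _ hfin,
    ncoeff_prod, prodMode_apply]
  refine finsum_congr fun l => ?_
  -- Along an antidiagonal only the binomials vary, and they sum to `binCoeff (p + q) l`.
  rw [hρ.prodTerm, ← sum_binCoeff_mul, Finset.sum_smul, LinearMap.sum_apply]
  refine Finset.sum_congr rfl fun ij hij => ?_
  rw [Finset.HasAntidiagonal.mem_antidiagonal.1 hij]
  rfl

/-! ### Elementary properties of the products -/

theorem signedSwap_add_left (x x' y : Module.End ℂ (Fock n)) :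
    signedSwap (x + x') y = signedSwap x y + signedSwap x' y := by
  simp only [signedSwap, mul_add, add_mul, mul_smul_comm, mul_sub]
  module

theorem signedSwap_smul_left (r : ℂ) (x y : Module.End ℂ (Fock n)) :
    signedSwap (r • x) y = r • signedSwap x y := by
  simp only [signedSwap, mul_add, mul_smul_comm, mul_sub, smul_mul_assoc]
  module

theorem signedSwap_add_right (x y y' : Module.End ℂ (Fock n)) :
    signedSwap x (y + y') = signedSwap x y + signedSwap x y' := by
  simp only [signedSwap, mul_add, add_mul, mul_smul_comm, mul_sub]
  module

theorem signedSwap_smul_right (r : ℂ) (x y : Module.End ℂ (Fock n)) :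
    signedSwap x (r • y) = r • signedSwap x y := by
  simp only [signedSwap, mul_add, mul_smul_comm, mul_sub, smul_mul_assoc]
  module

theorem signedSwap_one_right (x : Module.End ℂ (Fock n)) : signedSwap x 1 = x := by
  simp only [signedSwap, mul_one, one_mul, parity_mul_self]
  module

/-- The product `A_{(p)} B` as a bilinear map. -/
def prodₗ (p : ℤ) : FockField n →ₗ[ℂ] FockField n →ₗ[ℂ] FockField n :=
  LinearMap.mk₂ ℂ (fun A B => prod A p B)
    (fun A A' B => field_ext fun m => LinearMap.ext fun v => by
      rw [map_add, Pi.add_apply, LinearMap.add_apply, ncoeff_prod, ncoeff_prod, ncoeff_prod,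
        prodMode_apply, prodMode_apply, prodMode_apply,
        ← finsum_add_distrib (prodTerm_finite A p B m v) (prodTerm_finite A' p B m v)]
      refine finsum_congr fun j => ?_
      simp only [prodTerm, map_add, Pi.add_apply, signedSwap_add_left, add_mul,
        LinearMap.smul_apply, LinearMap.sub_apply, LinearMap.add_apply]
      module)
    (fun r A B => field_ext fun m => LinearMap.ext fun v => by
      rw [map_smul, Pi.smul_apply, LinearMap.smul_apply, ncoeff_prod, ncoeff_prod,
        prodMode_apply, prodMode_apply, smul_finsum' r (prodTerm_finite A p B m v)]
      refine finsum_congr fun j => ?_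
      simp only [prodTerm, map_smul, Pi.smul_apply, signedSwap_smul_left, smul_mul_assoc,
        LinearMap.smul_apply, LinearMap.sub_apply]
      module)
    (fun A B B' => field_ext fun m => LinearMap.ext fun v => by
      rw [map_add, Pi.add_apply, LinearMap.add_apply, ncoeff_prod, ncoeff_prod, ncoeff_prod,
        prodMode_apply, prodMode_apply, prodMode_apply,
        ← finsum_add_distrib (prodTerm_finite A p B m v) (prodTerm_finite A p B' m v)]
      refine finsum_congr fun j => ?_
      simp only [prodTerm, map_add, Pi.add_apply, signedSwap_add_right, mul_add,
        LinearMap.smul_apply, LinearMap.sub_apply, LinearMap.add_apply]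
      module)
    (fun r A B => field_ext fun m => LinearMap.ext fun v => by
      rw [map_smul, Pi.smul_apply, LinearMap.smul_apply, ncoeff_prod, ncoeff_prod,
        prodMode_apply, prodMode_apply, smul_finsum' r (prodTerm_finite A p B m v)]
      refine finsum_congr fun j => ?_
      simp only [prodTerm, map_smul, Pi.smul_apply, signedSwap_smul_right, mul_smul_comm,
        LinearMap.smul_apply, LinearMap.sub_apply]
      module)

theorem prodₗ_apply (p : ℤ) (A B : FockField n) : prodₗ p A B = prod A p B := rfl

/-! ### Translation: the derivative and products with the identity field -/

theorem finsum_sub_succ {V : Type*} [AddCommGroup V] (G : ℕ → V)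
    (hG : (Function.support G).Finite) : ∑ᶠ j, (G j - G (j + 1)) = G 0 := by
  obtain ⟨N, hN⟩ : ∃ N, ∀ j ≥ N, G j = 0 := by
    obtain ⟨N, hN⟩ := hG.bddAbove
    refine ⟨N + 1, fun j hj => ?_⟩
    by_contra hne
    exact absurd (hN hne) (by omega)
  rw [finsum_eq_sum_of_support_subset (s := Finset.range N), Finset.sum_range_sub', hN N le_rfl,
    sub_zero]
  intro j hj
  by_contra hlt
  simp only [Finset.coe_range, Set.mem_Iio, not_lt] at hlt
  exact hj (by simp only [hN j hlt, hN (j + 1) (by omega), sub_zero])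

theorem succ_mul_choose_succ (p : ℤ) (j : ℕ) :
    ((j : ℤ) + 1) * Ring.choose p (j + 1) = (p - j) * Ring.choose p j := by
  have h1 := Ring.descPochhammer_eq_factorial_smul_choose p j
  have h2 := Ring.descPochhammer_eq_factorial_smul_choose p (j + 1)
  rw [descPochhammer_succ_right, Polynomial.smeval_mul, h1] at h2
  have hX : (Polynomial.X - (j : Polynomial ℤ)).smeval p = p - j := by
    rw [Polynomial.smeval_sub, Polynomial.smeval_X, Polynomial.smeval_natCast]
    simp
  rw [hX, Nat.factorial_succ] at h2
  simp only [nsmul_eq_mul] at h2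
  have h3 : (j.factorial : ℤ) ≠ 0 := by exact_mod_cast j.factorial_ne_zero
  apply mul_left_cancel₀ h3
  push_cast at h2
  linarith

theorem succ_mul_choose_succ' (p : ℤ) (j : ℕ) :
    ((j : ℤ) + 1) * Ring.choose p (j + 1) = p * Ring.choose (p - 1) j := by
  have h1 := succ_mul_choose_succ (p - 1) j
  have h2 := Ring.choose_succ_succ (p - 1) j
  rw [sub_add_cancel] at h2
  rw [h2]
  linarith

theorem succ_mul_binCoeff_succ (p : ℤ) (j : ℕ) :
    ((j : ℂ) + 1) * binCoeff p (j + 1) = -(p * binCoeff (p - 1) j) := by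
  have h : ((j : ℂ) + 1) * (Ring.choose p (j + 1) : ℤ) = p * (Ring.choose (p - 1) j : ℤ) := by
    exact_mod_cast succ_mul_choose_succ' p j
  simp only [binCoeff, pow_succ]
  linear_combination -(-1 : ℂ) ^ j * h

theorem sub_mul_binCoeff (p : ℤ) (j : ℕ) :
    ((p : ℂ) - j) * binCoeff p j = p * binCoeff (p - 1) j := by
  have h : ((p : ℂ) - j) * (Ring.choose p j : ℤ) = p * (Ring.choose (p - 1) j : ℤ) := by
    exact_mod_cast (succ_mul_choose_succ p j).symm.trans (succ_mul_choose_succ' p j)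
  simp only [binCoeff]
  linear_combination (-1 : ℂ) ^ j * h

theorem prodTerm_eq (A : FockField n) (p : ℤ) (B : FockField n) (m : ℤ) (j : ℕ) :
    prodTerm A p B m j = binCoeff p j • (ncoeff A (p - j) * ncoeff B (m + j) -
      (-1 : ℂ) ^ p • signedSwap (ncoeff A j) (ncoeff B (p + m - j))) := rfl

/-- This is the Leibniz rule, with `-p A_{(p-1)}` for `(∂A)_{(p)}`. The difference of the `j`-th
summands is `G j - G (j + 1)` for `G j = j * binCoeff p j • A_{(p-j)} B_{(m-1+j)} v`, and the sum
telescopes to `G 0 = 0`; the swapped terms cancel for each `j` separately. -/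
theorem der_prod (A : FockField n) (p : ℤ) (B : FockField n) :
    der (prod A p B) = (-(p : ℂ)) • prod A (p - 1) B + prod A p (der B) := by
  refine field_ext fun m => LinearMap.ext fun v => ?_
  have f₁ := prodTerm_finite A p B (m - 1) v
  have f₂ := prodTerm_finite A (p - 1) B m v
  have f₃ := prodTerm_finite A p (der B) m v
  have f₁' : (Function.support fun j => (-(m : ℂ)) • prodTerm A p B (m - 1) j v).Finite :=
    finite_support_map f₁ ((-(m : ℂ)) • (1 : Module.End ℂ (Fock n)))
  have f₂' : (Function.support fun j => (-(p : ℂ)) • prodTerm A (p - 1) B m j v).Finite :=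
    finite_support_map f₂ ((-(p : ℂ)) • (1 : Module.End ℂ (Fock n)))
  have hG : (Function.support fun j : ℕ => ((j : ℂ) * binCoeff p j) •
      ncoeff A (p - j) (ncoeff B (m - 1 + j) v)).Finite := by
    obtain ⟨N, hN⟩ := ncoeff_eventually B v
    refine (Set.finite_lt_nat (N - m + 1).toNat).subset fun j hj => ?_
    by_contra hlt
    simp only [Set.mem_ofPred_eq, not_lt] at hlt
    exact hj (by simp only [hN (m - 1 + j) (by omega), map_zero, smul_zero])
  rw [ncoeff_der, map_add, map_smul, Pi.add_apply, Pi.smul_apply, LinearMap.add_apply,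
    LinearMap.smul_apply, LinearMap.smul_apply, ncoeff_prod, ncoeff_prod, ncoeff_prod,
    prodMode_apply, prodMode_apply, prodMode_apply, smul_finsum' _ f₁, smul_finsum' _ f₂,
    ← finsum_add_distrib f₂' f₃, ← sub_eq_zero,
    ← finsum_sub_distrib f₁' ((f₂'.union f₃).subset (Function.support_add _ _))]
  refine (finsum_congr fun j => ?_).trans ((finsum_sub_succ _ hG).trans (by simp))
  have e₁ := succ_mul_binCoeff_succ p j
  have e₂ := sub_mul_binCoeff p j
  simp only [prodTerm_eq, ncoeff_der, signedSwap_smul_right, LinearMap.smul_apply,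
    LinearMap.sub_apply, Module.End.mul_apply, map_smul, zpow_sub_one₀ (neg_ne_zero.2 one_ne_zero : (-1 : ℂ) ≠ 0)]
  rw [show p - 1 - (j : ℤ) = p - (j + 1 : ℕ) by push_cast; ring,
    show m - 1 + ((j + 1 : ℕ) : ℤ) = m + j by push_cast; ring,
    show m + (j : ℤ) - 1 = m - 1 + j by ring,
    show p - 1 + m - (j : ℤ) = p + (m - 1) - j by ring,
    show p + m - (j : ℤ) - 1 = p + (m - 1) - j by ring]
  push_cast
  rw [e₁]
  generalize ncoeff A (p - (j + 1)) (ncoeff B (m + j) v) = F'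
  generalize ncoeff A (p - j) (ncoeff B (m - 1 + j) v) = F
  generalize signedSwap (ncoeff A j) (ncoeff B (p + (m - 1) - j)) v = S
  match_scalars
  · ring
  · norm_num
    linear_combination -(-1 : ℂ) ^ p * e₂
  · ring

theorem prodTerm_one_right (A : FockField n) (p m : ℤ) (j : ℕ) :
    prodTerm A p one m j = binCoeff p j • ((if m + j = -1 then ncoeff A (p - j) else 0) -
      (-1 : ℂ) ^ p • (if p + m - j = -1 then ncoeff A j else 0)) := by
  have h : signedSwap (ncoeff A j) 0 = 0 := by simp [signedSwap]
  rw [prodTerm_eq, ncoeff_one, ncoeff_one]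
  split_ifs <;> simp only [mul_one, mul_zero, signedSwap_one_right, h]

theorem prod_neg_one_one (A : FockField n) : prod A (-1) one = A := by
  refine field_ext fun m => LinearMap.ext fun v => ?_
  rw [ncoeff_prod, prodMode_apply]
  -- A single `j` contributes: through the unswapped term when `m` is negative, through the swapped
  -- one otherwise.
  rcases lt_or_ge m 0 with hm | hm
  · rw [finsum_eq_single _ (-1 - m).toNat fun j hj => ?_]
    · rw [prodTerm_one_right, if_pos (by omega), if_neg (by omega), binCoeff_neg_one, one_smul,
        smul_zero, sub_zero, show -1 - (((-1 - m).toNat : ℕ) : ℤ) = m by omega]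
    · rw [prodTerm_one_right, if_neg (by omega), if_neg (by omega)]
      simp
  · rw [finsum_eq_single _ m.toNat fun j hj => ?_]
    · rw [prodTerm_one_right, if_neg (by omega), if_pos (by omega), binCoeff_neg_one, one_smul,
        show ((m.toNat : ℕ) : ℤ) = m by omega]
      simp
    · rw [prodTerm_one_right, if_neg (by omega), if_neg (by omega)]
      simp

theorem der_one : der (one : FockField n) = 0 := by
  refine field_ext fun m => ?_
  rw [ncoeff_der, ncoeff_one, map_zero, Pi.zero_apply]
  split_ifs with h
  · rw [show m = 0 by omega]
    simp
  · simp

/-- With the derivative written as a product, every closure or derivation property of products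
applies to it as well. -/
theorem prod_neg_two_one (A : FockField n) : prod A (-2) one = der A := by
  have h := der_prod A (-1) one
  rw [prod_neg_one_one, der_one, ← prodₗ_apply (-1) A 0, map_zero, add_zero] at h
  rw [h]
  norm_num

/-- The sole mode of the identity has index `-1`, reached neither by `r - j` nor by `j`. This
removes the central term when two creation operators of free fields are exchanged, since their
indices add up to at most `-2`. -/
theorem prod_one_of_lt {r : ℤ} (hr : r < -1) (B : FockField n) : prod one r B = 0 := by
  refine field_ext fun m => LinearMap.ext fun v => ?_
  rw [ncoeff_prod, prodMode_apply, map_zero]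
  refine (finsum_congr fun j => ?_).trans finsum_zero
  have h : signedSwap (n := n) 0 (ncoeff B (r + m - j)) = 0 := by simp [signedSwap]
  rw [prodTerm_eq, ncoeff_one, ncoeff_one, if_neg (by omega), if_neg (by omega), h]
  simp

/-! ### Parity of fields -/

/-- Conjugation of the modes of a field by the parity involution. -/
def conj : FockField n →ₗ[ℂ] FockField n where
  toFun A := ofModes (fun m => twist 1 (ncoeff A m)) (twist_eventually 1 A)
  map_add' A B := field_ext fun m => by
    simp only [map_add, Pi.add_apply, ncoeff_ofModes]
  map_smul' r A := field_ext fun m => by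
    simp only [map_smul, Pi.smul_apply, ncoeff_ofModes, RingHom.id_apply]

theorem ncoeff_conj (A : FockField n) (m : ℤ) : ncoeff (conj A) m = twist 1 (ncoeff A m) :=
  ncoeff_ofModes _ _ m

theorem homog_iff {e : ℕ} {A : FockField n} : Homog e A ↔ conj A = (-1 : ℂ) ^ e • A := by
  refine ⟨fun h => field_ext fun m => ?_, fun h m => ?_⟩
  · rw [ncoeff_conj, h m, map_smul, Pi.smul_apply]
  · rw [← ncoeff_conj, h, map_smul, Pi.smul_apply]

theorem twist_one_signedSwap (x y : Module.End ℂ (Fock n)) :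
    twist 1 (signedSwap x y) = signedSwap (twist 1 x) (twist 1 y) := by
  have h : ∀ z : Module.End ℂ (Fock n), parity * z * parity = twist 1 z := fun z => by
    rw [twist_apply, pow_one]
  simp only [signedSwap, h, map_add, map_sub, map_smul, twist_mul]

theorem conj_prod (A : FockField n) (p : ℤ) (B : FockField n) :
    conj (prod A p B) = prod (conj A) p (conj B) := by
  refine field_ext fun m => LinearMap.ext fun v => ?_
  rw [ncoeff_conj, ncoeff_prod, ncoeff_prod, twist_prodMode_apply, prodMode_apply]
  refine finsum_congr fun j => ?_
  simp only [prodTerm_eq, ncoeff_conj, map_smul, map_sub, twist_mul, twist_one_signedSwap]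

theorem Homog.prod {e f : ℕ} {A B : FockField n} (hA : Homog e A) (hB : Homog f B) (p : ℤ) :
    Homog (e + f) (BoundaryVOA.prod A p B) := by
  rw [homog_iff] at *
  rw [conj_prod, hA, hB, ← prodₗ_apply, map_smul, map_smul, LinearMap.smul_apply, smul_smul,
    prodₗ_apply, pow_add, mul_comm]

theorem homog_one : Homog 0 (one : FockField n) := by
  intro m
  rw [ncoeff_one]
  split_ifs <;> simp [twist_apply, parity_mul_self]

theorem Homog.add {e : ℕ} {A B : FockField n} (hA : Homog e A) (hB : Homog e B) :
    Homog e (A + B) := by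
  rw [homog_iff] at *
  rw [map_add, hA, hB, smul_add]

theorem Homog.smul {e : ℕ} {A : FockField n} (hA : Homog e A) (r : ℂ) : Homog e (r • A) := by
  rw [homog_iff] at *
  rw [map_smul, hA, smul_comm]

theorem Homog.sub {e : ℕ} {A B : FockField n} (hA : Homog e A) (hB : Homog e B) :
    Homog e (A - B) := by
  rw [homog_iff] at *
  rw [map_sub, hA, hB, smul_sub]

theorem Homog.mod_two {e : ℕ} {A : FockField n} (hA : Homog (e + 2) A) : Homog e A := by
  rw [homog_iff] at *
  rw [hA, pow_add]
  norm_num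

/-! ### Odd charges act by derivations -/

/-- The supercommutators of an odd operator `q` with the modes of `A`. -/
def superComm (q : Module.End ℂ (Fock n)) : Module.End ℂ (Fock n) →ₗ[ℂ] Module.End ℂ (Fock n) :=
  LinearMap.mulLeft ℂ q - (LinearMap.mulRight ℂ q).comp (twist 1)

theorem superComm_apply (q x : Module.End ℂ (Fock n)) :
    superComm q x = q * x - twist 1 x * q := rfl

theorem superComm_mul (q x y : Module.End ℂ (Fock n)) :
    superComm q (x * y) = superComm q x * y + twist 1 x * superComm q y := by
  simp only [superComm_apply, twist_mul]
  noncomm_ring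

theorem superComm_signedSwap {q : Module.End ℂ (Fock n)} (hq : twist 1 q = -q)
    (x y : Module.End ℂ (Fock n)) : superComm q (signedSwap x y) =
      signedSwap (superComm q x) y + signedSwap (twist 1 x) (superComm q y) := by
  have h : ∀ z : Module.End ℂ (Fock n), parity * z * parity = twist 1 z := fun z => by
    rw [twist_apply, pow_one]
  have h2 : ∀ z : Module.End ℂ (Fock n), twist 1 (twist 1 z) = z := fun z => by
    rw [twist_twist, twist_two_mul 1]
  simp only [signedSwap, h, superComm_apply, map_add, map_sub, map_smul, twist_mul, h2, hq,
    mul_add, mul_sub, sub_mul, mul_smul_comm, neg_mul, mul_neg, mul_assoc]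
  module

theorem ncoeff_prod_zero (A B : FockField n) (m : ℤ) :
    ncoeff (prod A 0 B) m = ncoeff A 0 * ncoeff B m - signedSwap (ncoeff A 0) (ncoeff B m) := by
  ext v
  rw [ncoeff_prod, prodMode_apply, finsum_eq_single _ 0 fun j hj => ?_]
  · simp [prodTerm]
  · obtain ⟨k, rfl⟩ := Nat.exists_eq_succ_of_ne_zero hj
    simp [prodTerm, Ring.choose_zero_succ]

theorem ncoeff_prod_zero_of_odd {J : FockField n} (hJ : Homog 1 J) (A : FockField n) (m : ℤ) :
    ncoeff (prod J 0 A) m = superComm (ncoeff J 0) (ncoeff A m) := by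
  rw [ncoeff_prod_zero, hJ.signedSwap, superComm_apply]

/-- The zero mode of an odd field is an odd derivation of all the products. -/
theorem prod_zero_prod {J : FockField n} (hJ : Homog 1 J) (A : FockField n) (p : ℤ)
    (B : FockField n) : prod J 0 (prod A p B) =
      prod (prod J 0 A) p B + prod (conj A) p (prod J 0 B) := by
  have hq : twist 1 (ncoeff J 0) = -ncoeff J 0 := by simpa using hJ 0
  refine field_ext fun m => LinearMap.ext fun v => ?_
  rw [map_add, Pi.add_apply, LinearMap.add_apply, ncoeff_prod_zero_of_odd hJ, ncoeff_prod,
    ncoeff_prod, ncoeff_prod, prodMode_apply, prodMode_apply,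
    ← finsum_add_distrib (prodTerm_finite _ _ _ _ _) (prodTerm_finite _ _ _ _ _),
    superComm_apply, LinearMap.sub_apply, Module.End.mul_apply, Module.End.mul_apply,
    prodMode_apply, twist_prodMode_apply, map_finsum _ (prodTerm_finite _ _ _ _ _),
    ← finsum_sub_distrib (finite_support_map (prodTerm_finite _ _ _ _ _) _)]
  · refine finsum_congr fun j => ?_
    -- Supercommutation with an odd operator is a derivation of the operator product and of
    -- `signedSwap`, so the rule holds for each summand.
    have h : ncoeff J 0 (prodTerm A p B m j v) - twist 1 (prodTerm A p B m j) (ncoeff J 0 v) =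
        superComm (ncoeff J 0) (prodTerm A p B m j) v := rfl
    rw [h]
    simp only [prodTerm_eq, map_smul, map_sub, superComm_mul, superComm_signedSwap hq,
      ncoeff_prod_zero_of_odd hJ, ncoeff_conj, LinearMap.smul_apply, LinearMap.sub_apply,
      LinearMap.add_apply]
    module
  · simp only [twist_apply, Module.End.mul_apply]
    exact finite_support_map (prodTerm_finite _ _ _ _ _) _

/-! ### Mode commutators -/

/-- `A_{(k)} B_{(l)} = s B_{(l)} A_{(k)} + ρ_{(k+l)}`: the operator product of `A` and `B` has at
most a simple pole, with residue `ρ`. -/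
def SimplePole (s : ℂ) (A B ρ : FockField n) : Prop := ∀ k l : ℤ,
  ncoeff A k * ncoeff B l = s • (ncoeff B l * ncoeff A k) + ncoeff ρ (k + l)

theorem SimplePole.add {s : ℂ} {A A' B ρ ρ' : FockField n} (h : SimplePole s A B ρ)
    (h' : SimplePole s A' B ρ') : SimplePole s (A + A') B (ρ + ρ') := by
  intro k l
  simp only [map_add, Pi.add_apply, add_mul, mul_add, h k l, h' k l]
  module

theorem SimplePole.sub {s : ℂ} {A A' B ρ ρ' : FockField n} (h : SimplePole s A B ρ)
    (h' : SimplePole s A' B ρ') : SimplePole s (A - A') B (ρ - ρ') := by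
  intro k l
  simp only [map_sub, Pi.sub_apply, sub_mul, mul_sub, h k l, h' k l]
  module

theorem SimplePole.sum {ι : Type*} {S : Finset ι} {s : ℂ} {A ρ : ι → FockField n}
    {B : FockField n} (h : ∀ a ∈ S, SimplePole s (A a) B (ρ a)) :
    SimplePole s (∑ a ∈ S, A a) B (∑ a ∈ S, ρ a) := by
  intro k l
  simp only [map_sum, Finset.sum_apply, Finset.sum_mul, Finset.mul_sum, Finset.smul_sum,
    ← Finset.sum_add_distrib]
  exact Finset.sum_congr rfl fun a ha => h a ha k l

theorem SimplePole.symm {s : ℂ} {A B ρ : FockField n} (h : SimplePole s A B ρ) (hs : s * s = 1) :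
    SimplePole s B A ((-s) • ρ) := by
  intro k l
  rw [h l k, map_smul, Pi.smul_apply, add_comm l k, smul_add, smul_smul, hs, neg_smul, one_smul]
  abel

theorem SimplePole.congr {s s' : ℂ} {A B ρ ρ' : FockField n} (h : SimplePole s A B ρ)
    (hs : s = s') (hρ : ρ = ρ') : SimplePole s' A B ρ' := hs ▸ hρ ▸ h

/-! ### The free fields -/

/-- A bosonic free field with creation modes `createB s` and annihilation modes
`ε • removeB t`. -/
def IsBoson (A : FockField n) (s t : Boson n) (ε : ℂ) : Prop :=
  ∀ m : ℤ, ncoeff A m = freeMode (createB s) (fun k => ε • removeB t k) m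

/-- A fermionic free field with creation modes `createF s` and annihilation modes
`removeF t`. -/
def IsFermion (A : FockField n) (s t : Fermion n) : Prop :=
  ∀ m : ℤ, ncoeff A m = freeMode (createF s) (removeF t) m

theorem isBoson_X (i : Fin n) : IsBoson (X i) (.X i) (.Y i) 1 := fun m => by
  simp only [one_smul]
  exact ncoeff_ofModes _ _ m

theorem isBoson_Y (i : Fin n) : IsBoson (Y i) (.Y i) (.X i) (-1) := fun m => by
  simp only [neg_smul, one_smul]
  exact ncoeff_ofModes _ _ m

theorem isFermion_psi (i : Fin n) : IsFermion (psi i) (.psi i) (.chi i) := fun m =>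
  ncoeff_ofModes _ _ m

theorem isFermion_chi (i : Fin n) : IsFermion (chi i) (.chi i) (.psi i) := fun m =>
  ncoeff_ofModes _ _ m

theorem isFermion_b (a : Fin (n - 1)) : IsFermion (b a) (.b a) (.c a) := fun m =>
  ncoeff_ofModes _ _ m

theorem isFermion_c (a : Fin (n - 1)) : IsFermion (c a) (.c a) (.b a) := fun m =>
  ncoeff_ofModes _ _ m

/-! ### Canonical commutation and anticommutation relations of the modes -/

theorem conj_mul_conj (x y : Module.End ℂ (BosonFock n ⊗[ℂ] FermionFock n)) :
    fockEquiv.conj x * fockEquiv.conj y = fockEquiv.conj (x * y) :=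
  (LinearEquiv.conj_comp _ _ _).symm

theorem createB_mul_createB (s t : Boson n) (k l : ℕ) :
    createB s k * createB t l = createB t l * createB s k := by
  rw [createB, createB, conj_mul_conj, conj_mul_conj, ← LinearMap.rTensor_mul,
    ← LinearMap.rTensor_mul]
  refine congrArg (fun z => fockEquiv.conj (LinearMap.rTensor (FermionFock n) z)) (LinearMap.ext fun p => ?_)
  simp [mul_left_comm]

theorem pderiv_pderiv_comm {σ : Type*} (s t : σ) (p : MvPolynomial σ ℂ) :
    MvPolynomial.pderiv s (MvPolynomial.pderiv t p) =
      MvPolynomial.pderiv t (MvPolynomial.pderiv s p) := by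
  classical
  have h : ⁅(MvPolynomial.pderiv s : Derivation ℂ (MvPolynomial σ ℂ) (MvPolynomial σ ℂ)),
      (MvPolynomial.pderiv t : Derivation ℂ (MvPolynomial σ ℂ) (MvPolynomial σ ℂ))⁆ = 0 := by
    refine MvPolynomial.derivation_ext (A := MvPolynomial σ ℂ) fun x => ?_
    rw [Derivation.commutator_apply]
    simp only [MvPolynomial.pderiv_X, Pi.single_apply]
    split_ifs <;> simp
  have h2 := DFunLike.congr_fun h p
  rwa [Derivation.commutator_apply, Derivation.zero_apply, sub_eq_zero] at h2

theorem removeB_mul_removeB (s t : Boson n) (k l : ℕ) :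
    removeB s k * removeB t l = removeB t l * removeB s k := by
  rw [removeB, removeB, conj_mul_conj, conj_mul_conj, ← LinearMap.rTensor_mul,
    ← LinearMap.rTensor_mul]
  exact congrArg (fun z => fockEquiv.conj (LinearMap.rTensor (FermionFock n) z))
    (LinearMap.ext fun p => pderiv_pderiv_comm _ _ p)

theorem removeB_mul_createB [DecidableEq (Boson n)] (s t : Boson n) (k l : ℕ) :
    removeB s k * createB t l =
      createB t l * removeB s k + if s = t ∧ k = l then 1 else 0 := by
  classical
  have h : (if s = t ∧ k = l then (1 : Module.End ℂ (Fock n)) else 0) =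
      fockEquiv.conj (LinearMap.rTensor (FermionFock n)
        (if s = t ∧ k = l then (1 : Module.End ℂ (BosonFock n)) else 0)) := by
    split_ifs
    · rw [Module.End.one_eq_id, Module.End.one_eq_id, LinearMap.rTensor_id, LinearEquiv.conj_id]
    · simp
  rw [h, removeB, createB, conj_mul_conj, conj_mul_conj, ← LinearMap.rTensor_mul,
    ← LinearMap.rTensor_mul, ← map_add, ← LinearMap.rTensor_add]
  refine congrArg (fun z => fockEquiv.conj (LinearMap.rTensor (FermionFock n) z)) (LinearMap.ext fun p => ?_)
  simp only [Module.End.mul_apply, LinearMap.add_apply, LinearMap.mulLeft_apply,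
    Derivation.coeFn_coe, Derivation.leibniz, MvPolynomial.pderiv_X, Pi.single_apply, Prod.mk.injEq, smul_eq_mul]
  congr 1
  by_cases hst : s = t ∧ k = l
  · simp [hst]
  · rw [if_neg hst, if_neg (fun h => hst ⟨h.1.symm, h.2.symm⟩)]
    simp

theorem createF_mul_createF (s t : Fermion n) (k l : ℕ) :
    createF s k * createF t l = -(createF t l * createF s k) := by
  rw [createF, createF, conj_mul_conj, conj_mul_conj, ← LinearMap.lTensor_mul,
    ← LinearMap.lTensor_mul, ← map_neg, ← LinearMap.lTensor_neg]
  refine congrArg (fun z => fockEquiv.conj (LinearMap.lTensor (BosonFock n) z)) (LinearMap.ext fun p => ?_)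
  simp only [Module.End.mul_apply, LinearMap.neg_apply, LinearMap.mulLeft_apply, ← mul_assoc]
  rw [← neg_mul]
  congr 1
  exact eq_neg_of_add_eq_zero_left (ExteriorAlgebra.ι_add_mul_swap _ _)

theorem removeF_mul_removeF (s t : Fermion n) (k l : ℕ) :
    removeF s k * removeF t l = -(removeF t l * removeF s k) := by
  rw [removeF, removeF, conj_mul_conj, conj_mul_conj, ← LinearMap.lTensor_mul,
    ← LinearMap.lTensor_mul, ← map_neg, ← LinearMap.lTensor_neg]
  refine congrArg (fun z => fockEquiv.conj (LinearMap.lTensor (BosonFock n) z)) (LinearMap.ext fun p => ?_)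
  exact CliffordAlgebra.contractLeft_comm _ _ _

theorem removeF_mul_createF [DecidableEq (Fermion n)] (s t : Fermion n) (k l : ℕ) :
    removeF s k * createF t l =
      -(createF t l * removeF s k) + if s = t ∧ k = l then 1 else 0 := by
  classical
  have h : (if s = t ∧ k = l then (1 : Module.End ℂ (Fock n)) else 0) =
      fockEquiv.conj (LinearMap.lTensor (BosonFock n)
        (if s = t ∧ k = l then (1 : Module.End ℂ (FermionFock n)) else 0)) := by
    split_ifs
    · rw [Module.End.one_eq_id, Module.End.one_eq_id, LinearMap.lTensor_id, LinearEquiv.conj_id]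
    · simp
  rw [h, removeF, createF, conj_mul_conj, conj_mul_conj, ← LinearMap.lTensor_mul,
    ← LinearMap.lTensor_mul, ← map_neg, ← LinearMap.lTensor_neg, ← map_add, ← LinearMap.lTensor_add]
  refine congrArg (fun z => fockEquiv.conj (LinearMap.lTensor (BosonFock n) z)) (LinearMap.ext fun p => ?_)
  simp only [Module.End.mul_apply, LinearMap.add_apply, LinearMap.neg_apply, LinearMap.mulLeft_apply]
  have h2 := CliffordAlgebra.contractLeft_ι_mul (Q := (0 : QuadraticForm ℂ ((Fermion n × ℕ) →₀ ℂ)))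
    (d := Finsupp.lapply (s, k)) (Finsupp.single (t, l) (1 : ℂ)) p
  refine h2.trans ?_
  rw [sub_eq_neg_add, Finsupp.lapply_apply, Finsupp.single_apply]
  simp only [Prod.mk.injEq]
  congr 1
  by_cases hst : s = t ∧ k = l
  · simp [hst]
  · rw [if_neg hst, if_neg (fun h => hst ⟨h.1.symm, h.2.symm⟩)]
    simp

theorem rTensor_mul_lTensor (x : Module.End ℂ (BosonFock n)) (y : Module.End ℂ (FermionFock n)) :
    fockEquiv.conj (LinearMap.rTensor (FermionFock n) x) *
      fockEquiv.conj (LinearMap.lTensor (BosonFock n) y) =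
    fockEquiv.conj (LinearMap.lTensor (BosonFock n) y) *
      fockEquiv.conj (LinearMap.rTensor (FermionFock n) x) := by
  rw [conj_mul_conj, conj_mul_conj, Module.End.mul_eq_comp, Module.End.mul_eq_comp,
    LinearMap.rTensor_comp_lTensor, LinearMap.lTensor_comp_rTensor]

theorem createB_mul_createF (s : Boson n) (t : Fermion n) (k l : ℕ) :
    createB s k * createF t l = createF t l * createB s k := rTensor_mul_lTensor _ _

theorem createB_mul_removeF (s : Boson n) (t : Fermion n) (k l : ℕ) :
    createB s k * removeF t l = removeF t l * createB s k := rTensor_mul_lTensor _ _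

theorem removeB_mul_createF (s : Boson n) (t : Fermion n) (k l : ℕ) :
    removeB s k * createF t l = createF t l * removeB s k := rTensor_mul_lTensor _ _

theorem removeB_mul_removeF (s : Boson n) (t : Fermion n) (k l : ℕ) :
    removeB s k * removeF t l = removeF t l * removeB s k := rTensor_mul_lTensor _ _

theorem ncoeff_smul_one (r : ℂ) (m : ℤ) :
    ncoeff (r • one : FockField n) m = if m = -1 then r • 1 else 0 := by
  rw [map_smul, Pi.smul_apply, ncoeff_one]
  split_ifs <;> simp

open scoped Classical in
-- An annihilator of `A` against a creator of `B` and a creator of `A` against an annihilator of `B`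
-- each give a constant. Hypothesis `h` makes the two agree, so that the commutator depends on `k +
-- l` only.
theorem IsBoson.simplePole {A B : FockField n} {s t s' t' : Boson n} {ε ε' : ℂ}
    (hA : IsBoson A s t ε) (hB : IsBoson B s' t' ε')
    (h : (if t = s' then ε else 0) = -(if t' = s then ε' else 0)) :
    SimplePole 1 A B ((if t = s' then ε else 0 : ℂ) • one) := by
  intro k l
  rw [hA, hB, one_smul, ncoeff_smul_one]
  rcases k with k | k <;> rcases l with l | l <;> simp only [freeMode]
  · rw [if_neg (by simp only [Int.ofNat_eq_natCast]; omega), smul_mul_smul_comm, smul_mul_smul_comm, removeB_mul_removeB t,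
      mul_comm ε, add_zero]
  · rw [smul_mul_assoc, mul_smul_comm, removeB_mul_createB, smul_add]
    congr 1
    by_cases hkl : k = l
    · rw [if_pos (show Int.ofNat k + Int.negSucc l = -1 by simp only [Int.ofNat_eq_natCast]; omega)]
      simp [hkl]
    · rw [if_neg (show ¬(Int.ofNat k + Int.negSucc l = -1) by simp only [Int.ofNat_eq_natCast]; omega)]
      simp [hkl]
  · rw [smul_mul_assoc, mul_smul_comm, removeB_mul_createB, smul_add, h, add_assoc]
    refine (add_zero _).symm.trans ?_
    congr 1
    by_cases hkl : l = k
    · rw [if_pos (show Int.negSucc k + Int.ofNat l = -1 by simp only [Int.ofNat_eq_natCast]; omega)]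
      split_ifs <;> simp_all
    · rw [if_neg (show ¬(Int.negSucc k + Int.ofNat l = -1) by simp only [Int.ofNat_eq_natCast]; omega)]
      simp [hkl]
  · rw [if_neg (by omega), createB_mul_createB, add_zero]

open scoped Classical in
theorem IsFermion.simplePole {A B : FockField n} {s t s' t' : Fermion n}
    (hA : IsFermion A s t) (hB : IsFermion B s' t') (h : t = s' ↔ t' = s) :
    SimplePole (-1) A B ((if t = s' then 1 else 0 : ℂ) • one) := by
  intro k l
  rw [hA, hB, neg_one_smul, ncoeff_smul_one]
  rcases k with k | k <;> rcases l with l | l <;> simp only [freeMode]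
  · rw [if_neg (by simp only [Int.ofNat_eq_natCast]; omega), removeF_mul_removeF t, add_zero]
  · rw [removeF_mul_createF]
    congr 1
    by_cases hkl : k = l
    · rw [if_pos (show Int.ofNat k + Int.negSucc l = -1 by simp only [Int.ofNat_eq_natCast]; omega)]
      split_ifs <;> simp_all
    · rw [if_neg (show ¬(Int.ofNat k + Int.negSucc l = -1) by simp only [Int.ofNat_eq_natCast]; omega)]
      simp [hkl]
  · rw [removeF_mul_createF, neg_add, neg_neg, add_assoc]
    refine (add_zero _).symm.trans ?_
    congr 1
    by_cases hkl : l = k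
    · rw [if_pos (show Int.negSucc k + Int.ofNat l = -1 by simp only [Int.ofNat_eq_natCast]; omega)]
      split_ifs <;> simp_all
    · rw [if_neg (show ¬(Int.negSucc k + Int.ofNat l = -1) by simp only [Int.ofNat_eq_natCast]; omega)]
      simp [hkl]
  · rw [if_neg (by omega), createF_mul_createF, add_zero]

theorem IsBoson.simplePole_fermion {A B : FockField n} {s t : Boson n} {s' t' : Fermion n} {ε : ℂ}
    (hA : IsBoson A s t ε) (hB : IsFermion B s' t') : SimplePole 1 A B 0 := by
  intro k l
  rw [hA, hB, one_smul, map_zero, Pi.zero_apply, add_zero]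
  rcases k with k | k <;> rcases l with l | l <;>
    simp only [freeMode, smul_mul_assoc, mul_smul_comm, createB_mul_createF, createB_mul_removeF,
      removeB_mul_createF, removeB_mul_removeF]

/-! ### Parity of the free fields -/

theorem IsBoson.homog {A : FockField n} {s t : Boson n} {ε : ℂ} (hA : IsBoson A s t ε) :
    Homog 0 A := by
  have h : ∀ x : Module.End ℂ (BosonFock n),
      twist 1 (fockEquiv.conj (LinearMap.rTensor (FermionFock n) x)) =
        fockEquiv.conj (LinearMap.rTensor (FermionFock n) x) := fun x => by
    rw [twist_apply, pow_one, parity, ← rTensor_mul_lTensor, ← parity, mul_assoc,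
      parity_mul_self, mul_one]
  intro m
  rw [hA, pow_zero, one_smul]
  rcases m with k | k <;> simp only [freeMode, map_smul]
  · rw [removeB, h]
  · rw [createB, h]

/-- Contraction lowers the exterior degree by one, so it is odd; the proof is by induction on left
multiplication by generators. -/
theorem involute_contractLeft (d : Module.Dual ℂ ((Fermion n × ℕ) →₀ ℂ)) (w : FermionFock n) :
    CliffordAlgebra.involute (CliffordAlgebra.contractLeft d w) =
      -CliffordAlgebra.contractLeft d (CliffordAlgebra.involute w) := by
  induction w using CliffordAlgebra.left_induction with
  | algebraMap r => simp [CliffordAlgebra.contractLeft_algebraMap]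
  | add x y hx hy => rw [map_add, map_add, hx, hy, map_add, map_add]; abel
  | ι_mul x m hx =>
    rw [CliffordAlgebra.contractLeft_ι_mul, map_sub, map_mul, map_mul, map_smul, hx,
      CliffordAlgebra.involute_ι, neg_mul, neg_mul, map_neg,
      CliffordAlgebra.contractLeft_ι_mul]
    simp

theorem IsFermion.homog {A : FockField n} {s t : Fermion n} (hA : IsFermion A s t) :
    Homog 1 A := by
  intro m
  rw [hA, pow_one, neg_one_smul]
  rcases m with k | k <;> simp only [freeMode]
  · rw [twist_apply, pow_one, parity, removeF, conj_mul_conj, conj_mul_conj,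
      ← LinearMap.lTensor_mul, ← LinearMap.lTensor_mul, ← map_neg, ← LinearMap.lTensor_neg]
    refine congrArg (fun z => fockEquiv.conj (LinearMap.lTensor (BosonFock n) z))
      (LinearMap.ext fun w => ?_)
    have h := involute_contractLeft (Finsupp.lapply (t, k)) (CliffordAlgebra.involute w)
    rw [CliffordAlgebra.involute_involute] at h
    exact h
  · rw [twist_apply, pow_one, parity, createF, conj_mul_conj, conj_mul_conj,
      ← LinearMap.lTensor_mul, ← LinearMap.lTensor_mul, ← map_neg, ← LinearMap.lTensor_neg]
    refine congrArg (fun z => fockEquiv.conj (LinearMap.lTensor (BosonFock n) z))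
      (LinearMap.ext fun w => ?_)
    simp only [Module.End.mul_apply, AlgHom.toLinearMap_apply, LinearMap.mulLeft_apply,
      LinearMap.neg_apply]
    refine (map_mul _ _ _).trans ?_
    rw [CliffordAlgebra.involute_involute, ← neg_mul]
    exact congrArg (· * w) (CliffordAlgebra.involute_ι _)

/-! ### Commutators with normally ordered products -/

/-- The `j`-th term of the mode `(AB)_{(m)}` of the normally ordered product, with the index of
`A` shifted by `k` and with sign `ε` for exchanging `A` and `B`. -/
def nopTerm (ε : ℂ) (A B : FockField n) (k m : ℤ) (v : Fock n) (j : ℕ) : Fock n :=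
  ncoeff A (k - 1 - j) (ncoeff B (m + j) v) + ε • ncoeff B (m - 1 - j) (ncoeff A (k + j) v)

theorem nopTerm_finite (ε : ℂ) (A B : FockField n) (k m : ℤ) (v : Fock n) :
    (Function.support (nopTerm ε A B k m v)).Finite := by
  obtain ⟨N, hN⟩ := ncoeff_eventually A v
  obtain ⟨M, hM⟩ := ncoeff_eventually B v
  refine (Set.finite_lt_nat (max (N - k).toNat (M - m).toNat)).subset fun j hj => ?_
  by_contra hlt
  simp only [Set.mem_ofPred_eq, not_lt] at hlt
  exact hj (by simp only [nopTerm, hN (k + j) (by omega), hM (m + j) (by omega), map_zero,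
    smul_zero, add_zero])

theorem ncoeff_nop_apply {e f : ℕ} {A B : FockField n} (hA : Homog e A) (hB : Homog f B) (m : ℤ)
    (v : Fock n) : ncoeff (nop A B) m v = ∑ᶠ j, nopTerm ((-1) ^ (e * f)) A B 0 m v j := by
  rw [nop, ncoeff_prod, prodMode_apply]
  refine finsum_congr fun j => ?_
  rw [hA.prodTerm, binCoeff_neg_one, hB.twist, nopTerm, zero_sub, zero_add,
    show -1 + m - (j : ℤ) = m - 1 - j by ring]
  simp

theorem finsum_ite_add_ite (l : ℤ) (x : Fock n) :
    ∑ᶠ j : ℕ, ((if (j : ℤ) = l then x else 0) + if (j : ℤ) = -1 - l then x else 0) = x := by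
  rcases lt_or_ge l 0 with hl | hl
  · rw [finsum_eq_single _ (-1 - l).toNat fun j hj => ?_]
    · rw [if_neg (by omega), if_pos (by omega), zero_add]
    · rw [if_neg (by omega), if_neg (by omega), zero_add]
  · rw [finsum_eq_single _ l.toNat fun j hj => ?_]
    · rw [if_pos (by omega), if_neg (by omega), add_zero]
    · rw [if_neg (by omega), if_neg (by omega), zero_add]

theorem finite_support_ite_add_ite (l : ℤ) (x : Fock n) :
    (Function.support fun j : ℕ =>
      (if (j : ℤ) = l then x else 0) + if (j : ℤ) = -1 - l then x else 0).Finite := by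
  refine (Set.finite_lt_nat (l.toNat + (-1 - l).toNat + 1)).subset fun j hj => ?_
  by_contra hlt
  simp only [Set.mem_ofPred_eq, not_lt] at hlt
  exact hj (by simp only [if_neg (show ¬((j : ℤ) = l) by omega),
    if_neg (show ¬((j : ℤ) = -1 - l) by omega), add_zero])

/-- Wick's theorem for a bilinear and a field that has central operator products with both
factors. -/
theorem SimplePole.nop {e f : ℕ} {A B φ : FockField n} {s₁ s₂ c₁ c₂ : ℂ} (hA : Homog e A)
    (hB : Homog f B) (h₁ : SimplePole s₁ A φ (c₁ • one)) (h₂ : SimplePole s₂ B φ (c₂ • one))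
    (hc₁ : (-1) ^ (e * f) * c₁ = s₂ * c₁) (hc₂ : (-1) ^ (e * f) * (s₁ * c₂) = c₂) :
    SimplePole (s₁ * s₂) (nop A B) φ ((s₂ * c₁) • B + c₂ • A) := by
  have h₁' : ∀ k l u, ncoeff A k (ncoeff φ l u) =
      s₁ • ncoeff φ l (ncoeff A k u) + if k + l = -1 then c₁ • u else 0 := fun k l u => by
    have := LinearMap.congr_fun (h₁ k l) u
    rw [ncoeff_smul_one] at this
    split_ifs at this ⊢ <;> simpa using this
  have h₂' : ∀ k l u, ncoeff B k (ncoeff φ l u) =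
      s₂ • ncoeff φ l (ncoeff B k u) + if k + l = -1 then c₂ • u else 0 := fun k l u => by
    have := LinearMap.congr_fun (h₂ k l) u
    rw [ncoeff_smul_one] at this
    split_ifs at this ⊢ <;> simpa using this
  intro k l
  refine LinearMap.ext fun v => ?_
  have fin₁ := finite_support_map (nopTerm_finite ((-1) ^ (e * f)) A B 0 k v)
    ((s₁ * s₂) • ncoeff φ l)
  have fin₂ := finite_support_ite_add_ite l ((s₂ * c₁) • ncoeff B (k + l) v)
  have fin₃ := finite_support_ite_add_ite (k + l) (c₂ • ncoeff A (k + l) v)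
  simp only [Module.End.mul_apply, LinearMap.add_apply, LinearMap.smul_apply, map_add, map_smul,
    Pi.add_apply, Pi.smul_apply]
  rw [ncoeff_nop_apply hA hB, ncoeff_nop_apply hA hB, ← LinearMap.smul_apply,
    map_finsum _ (nopTerm_finite _ A B 0 k v), ← finsum_ite_add_ite l ((s₂ * c₁) • ncoeff B (k + l) v),
    ← finsum_ite_add_ite (k + l) (c₂ • ncoeff A (k + l) v), ← finsum_add_distrib fin₂ fin₃,
    ← finsum_add_distrib fin₁ ((fin₂.union fin₃).subset (Function.support_add _ _))]
  refine finsum_congr fun j => ?_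
  simp only [nopTerm, h₁', h₂', map_add, map_smul, LinearMap.smul_apply, smul_add]
  -- Each central contribution occurs for one value of `j` at most. By the sign of `k + l`, either
  -- `e₁` or `e₄` supplies `c₂ • A_{(k+l)}`; by the sign of `l`, either `e₂` or `e₃` supplies the
  -- multiple of `B_{(k+l)}`. The sign hypotheses make the two alternatives agree.
  have e₁ : ncoeff A (0 - 1 - (j : ℤ)) (if k + j + l = -1 then c₂ • v else 0) =
      if (j : ℤ) = -1 - (k + l) then c₂ • ncoeff A (k + l) v else 0 := by
    by_cases hj : (j : ℤ) = -1 - (k + l)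
    · rw [if_pos (by omega), if_pos hj, map_smul, show 0 - 1 - (j : ℤ) = k + l by omega]
    · rw [if_neg (by omega), if_neg hj, map_zero]
  have e₂ : s₂ • (if 0 - 1 - (j : ℤ) + l = -1 then c₁ • ncoeff B (k + j) v else 0) =
      if (j : ℤ) = l then (s₂ * c₁) • ncoeff B (k + l) v else 0 := by
    by_cases hj : (j : ℤ) = l
    · rw [if_pos (by omega), if_pos hj, smul_smul, hj]
    · rw [if_neg (by omega), if_neg hj, smul_zero]
  have e₃ : (-1 : ℂ) ^ (e * f) • ncoeff B (k - 1 - j) (if 0 + (j : ℤ) + l = -1 then c₁ • v else 0) =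
      if (j : ℤ) = -1 - l then (s₂ * c₁) • ncoeff B (k + l) v else 0 := by
    by_cases hj : (j : ℤ) = -1 - l
    · rw [if_pos (by omega), if_pos hj, map_smul, smul_smul, hc₁,
        show k - 1 - (j : ℤ) = k + l by omega]
    · rw [if_neg (by omega), if_neg hj, map_zero, smul_zero]
  have e₄ : (-1 : ℂ) ^ (e * f) • s₁ •
      (if k - 1 - (j : ℤ) + l = -1 then c₂ • ncoeff A (0 + j) v else 0) =
      if (j : ℤ) = k + l then c₂ • ncoeff A (k + l) v else 0 := by
    by_cases hj : (j : ℤ) = k + l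
    · rw [if_pos (by omega), if_pos hj, smul_smul, smul_smul, mul_assoc, hc₂,
        show 0 + (j : ℤ) = k + l by omega]
    · rw [if_neg (by omega), if_neg hj, smul_zero, smul_zero]
  rw [e₁, e₂, e₃, e₄]
  module

/-- The shifted modes of a normally ordered product depend on the shift only through a central
term. -/
theorem finsum_nopTerm_shift {ε r : ℂ} {A B : FockField n} (h : SimplePole ε A B (r • one))
    (k N : ℤ) (v : Fock n) : ∑ᶠ j, nopTerm ε A B k (N - k) v j =
      ∑ᶠ j, nopTerm ε A B 0 N v j + if N = 0 then (k * r) • v else 0 := by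
  -- Raising the shift by one changes the sum by a telescoping series whose boundary term is the
  -- supercommutator of `A_{(k)}` and `B_{(N-k-1)}`; it is nonzero only if these indices add to
  -- `-1`, that is, if `N = 0`.
  have step : ∀ k : ℤ, ∑ᶠ j, nopTerm ε A B (k + 1) (N - (k + 1)) v j =
      ∑ᶠ j, nopTerm ε A B k (N - k) v j + if N = 0 then r • v else 0 := by
    intro k
    rw [← sub_eq_iff_eq_add', ← finsum_sub_distrib (nopTerm_finite _ _ _ _ _ _)
      (nopTerm_finite _ _ _ _ _ _)]
    have hG : (Function.support fun j : ℕ => ncoeff A (k - j) (ncoeff B (N - (k + 1) + j) v) -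
        ε • ncoeff B (N - (k + 1) - j) (ncoeff A (k + j) v)).Finite := by
      obtain ⟨M, hM⟩ := ncoeff_eventually A v
      obtain ⟨M', hM'⟩ := ncoeff_eventually B v
      refine (Set.finite_lt_nat (max (M - k).toNat (M' - N + k + 1).toNat)).subset fun j hj => ?_
      by_contra hlt
      simp only [Set.mem_ofPred_eq, not_lt] at hlt
      exact hj (by simp only [hM (k + j) (by omega), hM' (N - (k + 1) + j) (by omega), map_zero,
        smul_zero, sub_zero])
    have hend : ncoeff A k (ncoeff B (N - (k + 1)) v) - ε • ncoeff B (N - (k + 1)) (ncoeff A k v) =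
        if N = 0 then r • v else 0 := by
      have := LinearMap.congr_fun (h k (N - (k + 1))) v
      rw [ncoeff_smul_one] at this
      simp only [Module.End.mul_apply, LinearMap.add_apply, LinearMap.smul_apply] at this
      rw [this]
      by_cases hN : N = 0
      · rw [if_pos (by omega), if_pos hN]
        simp
      · rw [if_neg (by omega), if_neg hN]
        simp
    refine (finsum_congr fun j => ?_).trans ((finsum_sub_succ _ hG).trans (by simpa using hend))
    simp only [nopTerm]
    push_cast
    rw [show k + 1 - 1 - (j : ℤ) = k - j by ring, show k + 1 + (j : ℤ) = k + (j + 1) by ring,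
      show N - k + (j : ℤ) = N - (k + 1) + (j + 1) by ring,
      show k - 1 - (j : ℤ) = k - (j + 1) by ring,
      show N - (k + 1) - 1 - (j : ℤ) = N - (k + 1) - (j + 1) by ring,
      show N - k - 1 - (j : ℤ) = N - (k + 1) - j by ring]
    module
  induction k using Int.induction_on with
  | zero => simp
  | succ k ih =>
    rw [step, ih, add_assoc]
    congr 1
    split_ifs
    · push_cast; module
    · simp
  | pred k ih =>
    have := step (-k - 1)
    rw [sub_add_cancel, ih] at this
    rw [← sub_eq_iff_eq_add] at this
    rw [← this, add_sub_assoc]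
    congr 1
    split_ifs
    · push_cast; module
    · simp

/-- The commutator of a normally ordered product of two fields with opposite charges under a
current `K` with the modes of `K`. -/
theorem nop_mul_of_charge {e f : ℕ} {A B K : FockField n} {α r : ℂ} (hA : Homog e A)
    (hB : Homog f B) (hAB : SimplePole ((-1) ^ (e * f)) A B (r • one))
    (h₁ : SimplePole 1 A K (α • A)) (h₂ : SimplePole 1 B K ((-α) • B)) (k l : ℤ) :
    ncoeff (nop A B) k * ncoeff K l = ncoeff K l * ncoeff (nop A B) k +
      if k + l = 0 then (α * (l * r)) • 1 else 0 := by
  have h₁' : ∀ k l u, ncoeff A k (ncoeff K l u) =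
      ncoeff K l (ncoeff A k u) + α • ncoeff A (k + l) u := fun k l u => by
    simpa using LinearMap.congr_fun (h₁ k l) u
  have h₂' : ∀ k l u, ncoeff B k (ncoeff K l u) =
      ncoeff K l (ncoeff B k u) + (-α) • ncoeff B (k + l) u := fun k l u => by
    simpa using LinearMap.congr_fun (h₂ k l) u
  refine LinearMap.ext fun v => ?_
  have fin₁ := nopTerm_finite ((-1) ^ (e * f)) A B l k v
  have fin₂ := nopTerm_finite ((-1) ^ (e * f)) A B 0 (k + l) v
  have fin₃ := finite_support_map (nopTerm_finite ((-1) ^ (e * f)) A B 0 k v) (ncoeff K l)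
  have fin₄ : (Function.support fun j => nopTerm ((-1) ^ (e * f)) A B l k v j -
      nopTerm ((-1) ^ (e * f)) A B 0 (k + l) v j).Finite :=
    (fin₁.union fin₂).subset (Function.support_sub _ _)
  have fin₅ : (Function.support fun j => α • (nopTerm ((-1) ^ (e * f)) A B l k v j -
      nopTerm ((-1) ^ (e * f)) A B 0 (k + l) v j)).Finite :=
    finite_support_map fin₄ (α • (1 : Module.End ℂ (Fock n)))
  have hshift := finsum_nopTerm_shift hAB l (k + l) v
  rw [add_sub_cancel_right] at hshift
  -- Commuting with `K_{(l)}` adds `l` to the index of `A` with weight `α`, and to that of `B` with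
  -- weight `-α`. The two sums describe the same bilinear with cutoffs that differ by `l`, and the
  -- discrepancy is the Schwinger term.
  have hlast : (if k + l = 0 then (α * (l * r)) • (1 : Module.End ℂ (Fock n)) else 0) v =
      α • ∑ᶠ j, (nopTerm ((-1) ^ (e * f)) A B l k v j -
        nopTerm ((-1) ^ (e * f)) A B 0 (k + l) v j) := by
    rw [finsum_sub_distrib fin₁ fin₂, hshift, add_sub_cancel_left]
    split_ifs <;> simp [smul_smul]
  rw [Module.End.mul_apply, LinearMap.add_apply, Module.End.mul_apply, hlast,
    ncoeff_nop_apply hA hB, ncoeff_nop_apply hA hB, map_finsum _ (nopTerm_finite _ A B 0 k v),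
    smul_finsum' _ fin₄, ← finsum_add_distrib fin₃ fin₅]
  refine finsum_congr fun j => ?_
  simp only [nopTerm, h₁', h₂', map_add, map_smul]
  rw [show (0 : ℤ) - 1 - j + l = l - 1 - j by ring, show k + (j : ℤ) + l = k + l + j by ring,
    show (0 : ℤ) + j + l = l + j by ring, show k - 1 - (j : ℤ) + l = k + l - 1 - j by ring]
  module

/-! ### Operator products of the generators -/

/-- Kronecker's delta. -/
def delta {ι : Type*} [DecidableEq ι] (i j : ι) : ℂ := if i = j then 1 else 0

theorem delta_self {ι : Type*} [DecidableEq ι] (i : ι) : delta i i = 1 := if_pos rfl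

theorem delta_smul {ι : Type*} [DecidableEq ι] (i j : ι) (F : ι → FockField n) :
    delta i j • F i = delta i j • F j := by
  by_cases h : i = j
  · rw [h]
  · simp [delta, h]

theorem neg_delta_smul {ι : Type*} [DecidableEq ι] (i j : ι) (F : ι → FockField n) :
    (-delta i j) • F i = (-delta i j) • F j := by
  by_cases h : i = j
  · rw [h]
  · simp [delta, h]

theorem homog_X (i : Fin n) : Homog 0 (X i) := (isBoson_X i).homog
theorem homog_Y (i : Fin n) : Homog 0 (Y i) := (isBoson_Y i).homog
theorem homog_psi (i : Fin n) : Homog 1 (psi i) := (isFermion_psi i).homog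
theorem homog_chi (i : Fin n) : Homog 1 (chi i) := (isFermion_chi i).homog
theorem homog_c (a : Fin (n - 1)) : Homog 1 (c a) := (isFermion_c a).homog
theorem homog_b (a : Fin (n - 1)) : Homog 1 (b a) := (isFermion_b a).homog

theorem pole_X_X (i j : Fin n) : SimplePole 1 (X i) (X j) ((0 : ℂ) • one) := by
  classical
  exact ((isBoson_X i).simplePole (isBoson_X j) (by simp)).congr rfl (by simp)

theorem pole_Y_Y (i j : Fin n) : SimplePole 1 (Y i) (Y j) ((0 : ℂ) • one) := by
  classical
  exact ((isBoson_Y i).simplePole (isBoson_Y j) (by simp)).congr rfl (by simp)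

theorem pole_X_Y (i j : Fin n) : SimplePole 1 (X i) (Y j) (delta i j • one) := by
  classical
  exact ((isBoson_X i).simplePole (isBoson_Y j) (by split_ifs <;> simp_all)).congr rfl
    (by simp [delta])

theorem pole_Y_X (i j : Fin n) : SimplePole 1 (Y i) (X j) ((-delta i j) • one) := by
  classical
  refine ((isBoson_Y i).simplePole (isBoson_X j) (by split_ifs <;> simp_all)).congr rfl ?_
  by_cases h : i = j <;> simp [delta, h]

theorem pole_psi_psi (i j : Fin n) : SimplePole (-1) (psi i) (psi j) ((0 : ℂ) • one) := by
  classical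
  exact ((isFermion_psi i).simplePole (isFermion_psi j) (by simp)).congr rfl (by simp)

theorem pole_chi_chi (i j : Fin n) : SimplePole (-1) (chi i) (chi j) ((0 : ℂ) • one) := by
  classical
  exact ((isFermion_chi i).simplePole (isFermion_chi j) (by simp)).congr rfl (by simp)

theorem pole_psi_chi (i j : Fin n) : SimplePole (-1) (psi i) (chi j) (delta i j • one) := by
  classical
  exact ((isFermion_psi i).simplePole (isFermion_chi j) (by simp [eq_comm])).congr rfl
    (by simp [delta])

theorem pole_chi_psi (i j : Fin n) : SimplePole (-1) (chi i) (psi j) (delta i j • one) := by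
  classical
  exact ((isFermion_chi i).simplePole (isFermion_psi j) (by simp [eq_comm])).congr rfl
    (by simp [delta])

theorem pole_psi_c (i : Fin n) (a : Fin (n - 1)) :
    SimplePole (-1) (psi i) (c a) ((0 : ℂ) • one) := by
  classical
  exact ((isFermion_psi i).simplePole (isFermion_c a) (by simp)).congr rfl (by simp)

theorem pole_chi_c (i : Fin n) (a : Fin (n - 1)) :
    SimplePole (-1) (chi i) (c a) ((0 : ℂ) • one) := by
  classical
  exact ((isFermion_chi i).simplePole (isFermion_c a) (by simp)).congr rfl (by simp)

theorem pole_psi_b (i : Fin n) (a : Fin (n - 1)) :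
    SimplePole (-1) (psi i) (b a) ((0 : ℂ) • one) := by
  classical
  exact ((isFermion_psi i).simplePole (isFermion_b a) (by simp)).congr rfl (by simp)

theorem pole_chi_b (i : Fin n) (a : Fin (n - 1)) :
    SimplePole (-1) (chi i) (b a) ((0 : ℂ) • one) := by
  classical
  exact ((isFermion_chi i).simplePole (isFermion_b a) (by simp)).congr rfl (by simp)

theorem pole_c_b (a a' : Fin (n - 1)) : SimplePole (-1) (c a) (b a') (delta a a' • one) := by
  classical
  exact ((isFermion_c a).simplePole (isFermion_b a') (by simp [eq_comm])).congr rfl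
    (by simp [delta])

theorem IsBoson.pole_fermion {A B : FockField n} {s t : Boson n} {s' t' : Fermion n} {ε : ℂ}
    (hA : IsBoson A s t ε) (hB : IsFermion B s' t') : SimplePole 1 A B ((0 : ℂ) • one) :=
  (hA.simplePole_fermion hB).congr rfl (zero_smul _ _).symm

theorem IsFermion.pole_boson {A B : FockField n} {s t : Boson n} {s' t' : Fermion n} {ε : ℂ}
    (hA : IsFermion A s' t') (hB : IsBoson B s t ε) : SimplePole 1 A B ((0 : ℂ) • one) :=
  ((hB.pole_fermion hA).symm (by simp)).congr rfl (by simp)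

theorem SimplePole.zero_smul_one {s : ℂ} {A B : FockField n} (h : SimplePole s A B 0) :
    SimplePole s A B ((0 : ℂ) • one) := h.congr rfl (zero_smul _ _).symm

theorem homog_XY (i : Fin n) : Homog 0 (nop (X i) (Y i)) := (homog_X i).prod (homog_Y i) _

theorem homog_psichi (i : Fin n) : Homog 0 (nop (psi i) (chi i)) :=
  ((homog_psi i).prod (homog_chi i) _).mod_two

theorem homog_Mplus (i : Fin n) : Homog 1 (Mplus i) := (homog_X i).prod (homog_psi i) _

theorem homog_Mminus (i : Fin n) : Homog 1 (Mminus i) := (homog_Y i).prod (homog_chi i) _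

theorem pole_XY_X (i j : Fin n) :
    SimplePole 1 (nop (X i) (Y i)) (X j) ((-delta i j) • X j) :=
  (SimplePole.nop (homog_X i) (homog_Y i) (pole_X_X i j) (pole_Y_X i j) (by simp)
    (by simp)).congr (by simp) (by simp [neg_delta_smul i j X])

theorem pole_XY_Y (i j : Fin n) : SimplePole 1 (nop (X i) (Y i)) (Y j) (delta i j • Y j) :=
  (SimplePole.nop (homog_X i) (homog_Y i) (pole_X_Y i j) (pole_Y_Y i j) (by simp)
    (by simp)).congr (by simp) (by simp [delta_smul i j Y])

theorem pole_XY_fermion (i : Fin n) {B : FockField n} {s t : Fermion n} (hB : IsFermion B s t) :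
    SimplePole 1 (nop (X i) (Y i)) B 0 :=
  (SimplePole.nop (homog_X i) (homog_Y i) ((isBoson_X i).pole_fermion hB)
    ((isBoson_Y i).pole_fermion hB) (by simp) (by simp)).congr (by simp) (by simp)

theorem pole_psichi_boson (i : Fin n) {B : FockField n} {s t : Boson n} {ε : ℂ}
    (hB : IsBoson B s t ε) : SimplePole 1 (nop (psi i) (chi i)) B 0 :=
  (SimplePole.nop (homog_psi i) (homog_chi i) ((isFermion_psi i).pole_boson hB)
    ((isFermion_chi i).pole_boson hB) (by simp) (by simp)).congr (by simp) (by simp)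

theorem pole_psichi_psi (i j : Fin n) :
    SimplePole 1 (nop (psi i) (chi i)) (psi j) (delta i j • psi j) :=
  (SimplePole.nop (homog_psi i) (homog_chi i) (pole_psi_psi i j) (pole_chi_psi i j) (by simp)
    (by simp)).congr (by simp) (by simp [delta_smul i j psi])

theorem pole_psichi_chi (i j : Fin n) :
    SimplePole 1 (nop (psi i) (chi i)) (chi j) ((-delta i j) • chi j) :=
  (SimplePole.nop (homog_psi i) (homog_chi i) (pole_psi_chi i j) (pole_chi_chi i j) (by simp)
    (by simp)).congr (by simp) (by simp [neg_delta_smul i j chi])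

theorem pole_psichi_c (i : Fin n) (a : Fin (n - 1)) :
    SimplePole 1 (nop (psi i) (chi i)) (c a) 0 :=
  (SimplePole.nop (homog_psi i) (homog_chi i) (pole_psi_c i a) (pole_chi_c i a) (by simp)
    (by simp)).congr (by simp) (by simp)

theorem pole_psichi_b (i : Fin n) (a : Fin (n - 1)) :
    SimplePole 1 (nop (psi i) (chi i)) (b a) 0 :=
  (SimplePole.nop (homog_psi i) (homog_chi i) (pole_psi_b i a) (pole_chi_b i a) (by simp)
    (by simp)).congr (by simp) (by simp)

theorem pole_Mplus_Y (i j : Fin n) : SimplePole 1 (Mplus i) (Y j) (delta i j • psi i) :=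
  (SimplePole.nop (homog_X i) (homog_psi i) (pole_X_Y i j)
    ((isFermion_psi i).pole_boson (isBoson_Y j)) (by simp) (by simp)).congr (by simp) (by simp)

theorem pole_Mplus_chi (i j : Fin n) : SimplePole (-1) (Mplus i) (chi j) (delta i j • X i) :=
  (SimplePole.nop (homog_X i) (homog_psi i) ((isBoson_X i).pole_fermion (isFermion_chi j))
    (pole_psi_chi i j) (by simp) (by simp)).congr (by simp) (by simp)

theorem pole_Mminus_X (i j : Fin n) : SimplePole 1 (Mminus i) (X j) ((-delta i j) • chi i) :=
  (SimplePole.nop (homog_Y i) (homog_chi i) (pole_Y_X i j)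
    ((isFermion_chi i).pole_boson (isBoson_X j)) (by simp) (by simp)).congr (by simp) (by simp)

theorem pole_Mminus_psi (i j : Fin n) : SimplePole (-1) (Mminus i) (psi j) (delta i j • Y i) :=
  (SimplePole.nop (homog_Y i) (homog_chi i) ((isBoson_Y i).pole_fermion (isFermion_psi j))
    (pole_chi_psi i j) (by simp) (by simp)).congr (by simp) (by simp)

theorem pole_Mplus_c (i : Fin n) (a : Fin (n - 1)) : SimplePole (-1) (Mplus i) (c a) 0 :=
  (SimplePole.nop (homog_X i) (homog_psi i) ((isBoson_X i).pole_fermion (isFermion_c a))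
    (pole_psi_c i a) (by simp) (by simp)).congr (by simp) (by simp)

theorem pole_Mminus_c (i : Fin n) (a : Fin (n - 1)) : SimplePole (-1) (Mminus i) (c a) 0 :=
  (SimplePole.nop (homog_Y i) (homog_chi i) ((isBoson_Y i).pole_fermion (isFermion_c a))
    (pole_chi_c i a) (by simp) (by simp)).congr (by simp) (by simp)

/-! ### The gauge currents -/

/-- The current `J_i = X_i Y_i + ψ_i χ_i`. -/
def current (i : Fin n) : FockField n := nop (X i) (Y i) + nop (psi i) (chi i)

theorem homog_current (i : Fin n) : Homog 0 (current i) := (homog_XY i).add (homog_psichi i)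

theorem pole_X_current (i j : Fin n) : SimplePole 1 (X i) (current j) (delta j i • X i) :=
  (((pole_XY_X j i).add (pole_psichi_boson j (isBoson_X i))).symm (by simp)).congr rfl (by module)

theorem pole_Y_current (i j : Fin n) : SimplePole 1 (Y i) (current j) ((-delta j i) • Y i) :=
  (((pole_XY_Y j i).add (pole_psichi_boson j (isBoson_Y i))).symm (by simp)).congr rfl (by module)

theorem pole_psi_current (i j : Fin n) : SimplePole 1 (psi i) (current j) ((-delta j i) • psi i) :=
  (((pole_XY_fermion j (isFermion_psi i)).add (pole_psichi_psi j i)).symm (by simp)).congr rfl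
    (by module)

theorem pole_chi_current (i j : Fin n) : SimplePole 1 (chi i) (current j) (delta j i • chi i) :=
  (((pole_XY_fermion j (isFermion_chi i)).add (pole_psichi_chi j i)).symm (by simp)).congr rfl
    (by module)

/-- The Schwinger terms cancel between bosons and fermions: `X_i Y_i` and `ψ_i χ_i` have the same
contraction `1`, but `X_i` and `ψ_i` carry opposite charges. -/
theorem pole_current_current (i j : Fin n) : SimplePole 1 (current i) (current j) 0 := by
  intro k l
  have h₁ := nop_mul_of_charge (K := current j) (r := 1) (homog_X i) (homog_Y i)
    ((pole_X_Y i i).congr (by simp) (by simp [delta_self])) (pole_X_current i j)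
    (pole_Y_current i j) k l
  have h₂ := nop_mul_of_charge (K := current j) (r := 1) (homog_psi i) (homog_chi i)
    ((pole_psi_chi i i).congr (by simp) (by simp [delta_self])) (pole_psi_current i j)
    ((pole_chi_current i j).congr rfl (by simp)) k l
  rw [current, map_add, Pi.add_apply, add_mul, mul_add, h₁, h₂]
  split_ifs
  · simp only [one_smul, map_zero, Pi.zero_apply]
    module
  · simp

/-- The charges of `X_i` and `ψ_i` add to zero, and the two fields do not contract with each other,
so no central term arises. -/
theorem pole_current_Mplus (i j : Fin n) : SimplePole 1 (current j) (Mplus i) 0 := by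
  refine (SimplePole.symm (s := 1) (ρ := 0) (fun k l => ?_) (by simp)).congr rfl (by simp)
  have h := nop_mul_of_charge (K := current j) (r := 0) (homog_X i) (homog_psi i)
    (((isBoson_X i).pole_fermion (isFermion_psi i)).congr (by simp) rfl) (pole_X_current i j)
    (pole_psi_current i j) k l
  rw [Mplus, h]
  simp

theorem pole_current_Mminus (i j : Fin n) : SimplePole 1 (current j) (Mminus i) 0 := by
  refine (SimplePole.symm (s := 1) (ρ := 0) (fun k l => ?_) (by simp)).congr rfl (by simp)
  have h := nop_mul_of_charge (K := current j) (r := 0) (homog_Y i) (homog_chi i)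
    (((isBoson_Y i).pole_fermion (isFermion_chi i)).congr (by simp) rfl) (pole_Y_current i j)
    ((pole_chi_current i j).congr rfl (by simp)) k l
  rw [Mminus, h]
  simp

theorem pole_c_current (a : Fin (n - 1)) (i : Fin n) : SimplePole 1 (c a) (current i) 0 :=
  (((pole_XY_fermion i (isFermion_c a)).add (pole_psichi_c i a)).symm (by simp)).congr rfl (by simp)

theorem pole_current_b (i : Fin n) (a : Fin (n - 1)) : SimplePole 1 (current i) (b a) 0 :=
  ((pole_XY_fermion i (isFermion_b a)).add (pole_psichi_b i a)).congr rfl (by simp)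

/-! ### The BRST charge -/

/-- The difference of the currents at adjacent nodes. -/
def gauge (a : Fin (n - 1)) : FockField n := current (node a) - current (nodeSucc a)

theorem currentBRST_eq : currentBRST n = ∑ a : Fin (n - 1), nop (c a) (gauge a) := by
  refine Finset.sum_congr rfl fun a _ => congrArg _ ?_
  rw [gauge, current, current]
  abel

theorem homog_gauge (a : Fin (n - 1)) : Homog 0 (gauge a : FockField n) :=
  (homog_current _).sub (homog_current _)

theorem homog_currentBRST : Homog 1 (currentBRST n) := by
  rw [currentBRST_eq, homog_iff, map_sum, Finset.smul_sum]
  exact Finset.sum_congr rfl fun a _ => homog_iff.1 ((homog_c a).prod (homog_gauge a) _)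

/-- The zero mode of the BRST current picks out the residue of a simple pole. -/
theorem Q_eq_of_simplePole {e : ℕ} {A ρ : FockField n} (hA : Homog e A)
    (h : SimplePole ((-1) ^ e) (currentBRST n) A ρ) : Q A = ρ := by
  refine field_ext fun m => ?_
  rw [Q, ncoeff_prod_zero_of_odd homog_currentBRST, superComm_apply, h 0 m, hA m, zero_add,
    smul_mul_assoc, add_sub_cancel_left]

/-- A field that commutes with the gauge currents and supercommutes with the ghosts `c^a` is
closed. -/
theorem Q_eq_zero {e : ℕ} {A : FockField n} (hA : Homog e A)
    (hc : ∀ a, SimplePole ((-1) ^ e) (c a) A 0) (hJ : ∀ i, SimplePole 1 (current i) A 0) :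
    Q A = 0 := by
  refine Q_eq_of_simplePole hA ?_
  rw [currentBRST_eq]
  refine (SimplePole.sum (ρ := fun _ => 0) fun a _ => ?_).congr rfl Finset.sum_const_zero
  exact (SimplePole.nop (homog_c a) (homog_gauge a) (hc a).zero_smul_one
    (((hJ _).sub (hJ _)).congr rfl (sub_zero _)).zero_smul_one (by simp) (by simp)).congr
    (by simp) (by simp)

theorem Q_current (i : Fin n) : Q (current i) = 0 :=
  Q_eq_zero (homog_current i) (fun a => (pole_c_current a i).congr (by simp) rfl)
    fun j => pole_current_current j i

theorem Q_Mplus (i : Fin n) : Q (Mplus i) = 0 :=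
  Q_eq_zero (homog_Mplus i)
    (fun a => ((pole_Mplus_c i a).symm (by simp)).congr (by simp) (by simp))
    fun j => pole_current_Mplus i j

theorem Q_Mminus (i : Fin n) : Q (Mminus i) = 0 :=
  Q_eq_zero (homog_Mminus i)
    (fun a => ((pole_Mminus_c i a).symm (by simp)).congr (by simp) (by simp))
    fun j => pole_current_Mminus i j

/-- Contracting `b_a` with `c^a` leaves the gauge current. This is the source of all the exact terms
used. -/
theorem Q_b (a : Fin (n - 1)) : Q (b a : FockField n) = gauge a := by
  refine Q_eq_of_simplePole (homog_b a) ?_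
  rw [currentBRST_eq]
  refine (SimplePole.sum (s := -1) (ρ := fun a' => delta a' a • gauge a') fun a' _ => ?_).congr
    (by simp) ?_
  · exact (SimplePole.nop (homog_c a') (homog_gauge a') (pole_c_b a' a)
      (((pole_current_b _ a).sub (pole_current_b _ a)).congr rfl (sub_zero _)).zero_smul_one
      (by simp) (by simp)).congr (by simp) (by simp)
  · simp [delta]

/-! ### The Weyl algebra computation -/

/-- Operators that satisfy the commutation relations of the creation modes of `X_i`, `Y_i`, `ψ_i`,
`χ_i` (with `x k` for `X_{i,(-k-1)}`, and so on) and of the modes of degree `-1` of `X_i Y_i`,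
`ψ_i χ_i`, `X_i ψ_i`, `Y_i χ_i`, together with their values on a vacuum vector. -/
structure CreationRelations {V : Type*} [AddCommGroup V] [Module ℂ V]
    (x y f g : ℕ → Module.End ℂ V) (α β μ ν : Module.End ℂ V) (o : V) : Prop where
  x_x : ∀ k l B, x k (x l B) = x l (x k B)
  y_y : ∀ k l B, y k (y l B) = y l (y k B)
  f_f : ∀ k B, f k (f k B) = 0
  g_g : ∀ k B, g k (g k B) = 0
  y_x : ∀ k l B, y k (x l B) = x l (y k B)
  f_x : ∀ k l B, f k (x l B) = x l (f k B)
  f_y : ∀ k l B, f k (y l B) = y l (f k B)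
  g_x : ∀ k l B, g k (x l B) = x l (g k B)
  g_y : ∀ k l B, g k (y l B) = y l (g k B)
  g_f : ∀ k l B, g k (f l B) = -f l (g k B)
  α_x : ∀ k B, α (x k B) = x k (α B) - x (k + 1) B
  α_y : ∀ k B, α (y k B) = y k (α B) + y (k + 1) B
  α_f : ∀ k B, α (f k B) = f k (α B)
  α_g : ∀ k B, α (g k B) = g k (α B)
  β_x : ∀ k B, β (x k B) = x k (β B)
  β_y : ∀ k B, β (y k B) = y k (β B)
  β_f : ∀ k B, β (f k B) = f k (β B) + f (k + 1) B
  β_g : ∀ k B, β (g k B) = g k (β B) - g (k + 1) B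
  μ_y : ∀ k B, μ (y k B) = y k (μ B) + f (k + 1) B
  μ_g : ∀ k B, μ (g k B) = -g k (μ B) + x (k + 1) B
  ν_x : ∀ k B, ν (x k B) = x k (ν B) - g (k + 1) B
  ν_f : ∀ k B, ν (f k B) = -f k (ν B) + y (k + 1) B
  α_o : α o = x 0 (y 0 o)
  β_o : β o = f 0 (g 0 o)
  μ_o : μ o = x 0 (f 0 o)
  ν_o : ν o = y 0 (g 0 o)

section

variable {V : Type*} [AddCommGroup V] [Module ℂ V] {x y f g : ℕ → Module.End ℂ V}
  {α β μ ν : Module.End ℂ V} {o : V}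

/-- As rewriting rules, the relations move `α, β, μ, ν` to the right until they hit `o` and put the
creation operators in a fixed order. In the result, the commutator of `μ` and `ν` cancels the mixed
and purely fermionic words of the square of `α + β`. -/
theorem CreationRelations.quadratic (h : CreationRelations x y f g α β μ ν o) :
    (1 / 2 : ℂ) • ((-α (-α o) + x 0 (y 0 (-α o))) + -α (-α o)) =
      (1 / 2 : ℂ) • (α + β) ((α + β) o) - (1 / 2 : ℂ) • (μ (ν o) - ν (μ o)) := by
  simp only [h.g_g, h.y_x, h.f_x, h.f_y, h.g_x, h.g_y,
    h.g_f, h.α_x, h.α_y, h.α_f, h.α_g, h.β_x, h.β_y, h.β_f, h.β_g, h.μ_y, h.μ_g,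
    h.ν_x, h.ν_f, h.α_o, h.β_o, h.μ_o, h.ν_o, map_add, map_sub, map_neg,
    map_zero, LinearMap.add_apply, zero_add]
  module

/-- The same reduction to ordered words, one degree higher. On the right, the arguments of `μ` and
`ν` stand for `∂M^-` and `∂M^+`, and the last bracket, with its factor `2`, for the second
derivative of the current. -/
theorem CreationRelations.cubic (h : CreationRelations x y f g α β μ ν o) :
    (-α (-α (-α o) + x 0 (y 0 (-α o))) + x 0 (y 0 (-α (-α o) + x 0 (y 0 (-α o))))) +
        (1 / 2 : ℂ) • (-α (-α (-α o)) + x 0 (y 0 (-α (-α o)))) +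
        (1 / 2 : ℂ) • -α (-α (-α o) + x 0 (y 0 (-α o))) + -α (-α (-α o)) =
      (3 / 2 : ℂ) • (μ (y 1 (g 0 o) + y 0 (g 1 o)) + ν (x 1 (f 0 o) + x 0 (f 1 o))) +
        (3 / 2 : ℂ) • (α + β) (μ (ν o) - ν (μ o)) - (α + β) ((α + β) ((α + β) o)) -
        (2 : ℂ) • (x 2 (y 0 o) + x 1 (y 1 o) + x 0 (y 2 o) +
          (f 2 (g 0 o) + f 1 (g 1 o) + f 0 (g 2 o))) := by
  simp only [h.x_x, h.y_y, h.f_f, h.g_g, h.y_x, h.f_x, h.f_y, h.g_x, h.g_y,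
    h.g_f, h.α_x, h.α_y, h.α_f, h.α_g, h.β_x, h.β_y, h.β_f, h.β_g, h.μ_y, h.μ_g,
    h.ν_x, h.ν_f, h.α_o, h.β_o, h.μ_o, h.ν_o, map_add, map_sub, map_neg,
    map_zero, LinearMap.add_apply, zero_add, Nat.reduceAdd]
  module

end

/-! ### Exact form of `T_i` and `W_i` -/

theorem neg_one_smul_field (A : FockField n) : (-1 : ℂ) • A = -A := by module

/-- Parity matters only modulo two. This form is needed because the residue of two odd fields must
be presented with parity `1 + 1`. -/
theorem Homog.add_two {e : ℕ} {A : FockField n} (hA : Homog e A) : Homog (e + 2) A := by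
  rw [homog_iff] at *
  rw [hA, pow_add]
  norm_num

theorem SimplePole.prodₗ {e f : ℕ} {a φ ρ : FockField n} (ha : Homog e a) (hφ : Homog f φ)
    (hρ : Homog (e + f) ρ) (h : SimplePole ((-1) ^ (e * f)) a φ ρ) (p q : ℤ) (B : FockField n) :
    BoundaryVOA.prodₗ p a (BoundaryVOA.prodₗ q φ B) =
      (-1 : ℂ) ^ (e * f) • BoundaryVOA.prodₗ q φ (BoundaryVOA.prodₗ p a B) +
        BoundaryVOA.prodₗ (p + q) ρ B :=
  prod_prod ha hφ hρ h p q B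

theorem SimplePole.prodₗ_of_central {e f : ℕ} {a φ : FockField n} {r : ℂ} (ha : Homog e a)
    (hφ : Homog f φ) (hef : Even (e + f)) (h : SimplePole ((-1) ^ (e * f)) a φ (r • one))
    {p q : ℤ} (hpq : p + q < -1) (B : FockField n) :
    BoundaryVOA.prodₗ p a (BoundaryVOA.prodₗ q φ B) =
      (-1 : ℂ) ^ (e * f) • BoundaryVOA.prodₗ q φ (BoundaryVOA.prodₗ p a B) := by
  have hρ : Homog (e + f) (r • one : FockField n) := by
    rw [homog_iff, hef.neg_one_pow, one_smul, map_smul, homog_iff.1 homog_one, pow_zero, one_smul]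
  rw [SimplePole.prodₗ ha hφ hρ h, map_smul, LinearMap.smul_apply,
    prodₗ_apply (p + q) one B, prod_one_of_lt hpq, smul_zero, add_zero]

theorem SimplePole.prodₗ_of_zero {e f : ℕ} {a φ : FockField n} (ha : Homog e a)
    (hφ : Homog f φ) (h : SimplePole ((-1) ^ (e * f)) a φ 0) (p q : ℤ) (B : FockField n) :
    BoundaryVOA.prodₗ p a (BoundaryVOA.prodₗ q φ B) =
      (-1 : ℂ) ^ (e * f) • BoundaryVOA.prodₗ q φ (BoundaryVOA.prodₗ p a B) := by
  have hρ : Homog (e + f) (0 : FockField n) := by rw [homog_iff, map_zero, smul_zero]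
  rw [SimplePole.prodₗ ha hφ hρ h, map_zero, LinearMap.zero_apply, add_zero]

theorem SimplePole.of_smul_one_zero {s : ℂ} {A B : FockField n}
    (h : SimplePole s A B ((0 : ℂ) • one)) : SimplePole s A B 0 := h.congr rfl (zero_smul _ _)

/-- Each commutation relation transports a simple-pole relation of modes to left multiplications. A
bilinear acts at index `-1`, so its residue with a creation operator at `-1 - k` sits at `-1 - (k +
1)`; this is the shift by one in the relations. -/
theorem creationRelations (i : Fin n) :
    CreationRelations (fun k : ℕ => prodₗ (-1 - k) (X i)) (fun k : ℕ => prodₗ (-1 - k) (Y i))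
      (fun k : ℕ => prodₗ (-1 - k) (psi i)) (fun k : ℕ => prodₗ (-1 - k) (chi i))
      (prodₗ (-1) (nop (X i) (Y i))) (prodₗ (-1) (nop (psi i) (chi i))) (prodₗ (-1) (Mplus i))
      (prodₗ (-1) (Mminus i)) one := by
  have hidx : ∀ k : ℕ, (-1 : ℤ) + (-1 - k) = -1 - (k + 1 : ℕ) := fun k => by push_cast; ring
  have hfx := fun k l : ℕ => SimplePole.prodₗ_of_zero (homog_psi i) (homog_X i)
    (((isFermion_psi i).pole_boson (isBoson_X i)).of_smul_one_zero.congr (by simp) rfl)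
    (-1 - k) (-1 - l)
  have hfy := fun k l : ℕ => SimplePole.prodₗ_of_zero (homog_psi i) (homog_Y i)
    (((isFermion_psi i).pole_boson (isBoson_Y i)).of_smul_one_zero.congr (by simp) rfl)
    (-1 - k) (-1 - l)
  have hgx := fun k l : ℕ => SimplePole.prodₗ_of_zero (homog_chi i) (homog_X i)
    (((isFermion_chi i).pole_boson (isBoson_X i)).of_smul_one_zero.congr (by simp) rfl)
    (-1 - k) (-1 - l)
  have hgy := fun k l : ℕ => SimplePole.prodₗ_of_zero (homog_chi i) (homog_Y i)
    (((isFermion_chi i).pole_boson (isBoson_Y i)).of_smul_one_zero.congr (by simp) rfl)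
    (-1 - k) (-1 - l)
  have hself : ∀ {φ : FockField n}, Homog 1 φ → SimplePole (-1) φ φ ((0 : ℂ) • one) →
      ∀ (k : ℕ) (B : FockField n), prodₗ (-1 - k) φ (prodₗ (-1 - k) φ B) = 0 := by
    intro φ hφ hpole k B
    have h := SimplePole.prodₗ_of_zero hφ hφ (hpole.of_smul_one_zero.congr (by simp) rfl)
      (-1 - k) (-1 - k) B
    rw [mul_one, pow_one] at h
    -- An odd creation operator anticommutes with itself, so twice its square vanishes.
    have h2 : (2 : ℂ) • prodₗ (-1 - k) φ (prodₗ (-1 - k) φ B) = 0 := by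
      nth_rewrite 1 [two_smul, h]
      module
    exact (smul_eq_zero.1 h2).resolve_left two_ne_zero
  exact {
    x_x := fun k l B => by
      simpa using SimplePole.prodₗ_of_zero (homog_X i) (homog_X i)
        ((pole_X_X i i).of_smul_one_zero.congr (by simp) rfl) (-1 - k) (-1 - l) B
    y_y := fun k l B => by
      simpa using SimplePole.prodₗ_of_zero (homog_Y i) (homog_Y i)
        ((pole_Y_Y i i).of_smul_one_zero.congr (by simp) rfl) (-1 - k) (-1 - l) B
    f_f := hself (homog_psi i) (pole_psi_psi i i)
    g_g := hself (homog_chi i) (pole_chi_chi i i)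
    y_x := fun k l B => by
      simpa using SimplePole.prodₗ_of_central (homog_Y i) (homog_X i) (by simp)
        ((pole_Y_X i i).congr (by simp) rfl) (p := -1 - k) (q := -1 - l) (by omega) B
    f_x := fun k l B => by simpa using hfx k l B
    f_y := fun k l B => by simpa using hfy k l B
    g_x := fun k l B => by simpa using hgx k l B
    g_y := fun k l B => by simpa using hgy k l B
    g_f := fun k l B => by
      simpa [neg_one_smul_field] using SimplePole.prodₗ_of_central (homog_chi i) (homog_psi i) (by decide)
        ((pole_chi_psi i i).congr (by simp) rfl) (p := -1 - k) (q := -1 - l) (by omega) B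
    α_x := fun k B => by
      have h := SimplePole.prodₗ (homog_XY i) (homog_X i) ((homog_X i).smul _)
        ((pole_XY_X i i).congr (by simp) rfl) (-1) (-1 - k) B
      rw [hidx] at h
      simpa [delta_self, sub_eq_add_neg] using h
    α_y := fun k B => by
      have h := SimplePole.prodₗ (homog_XY i) (homog_Y i) ((homog_Y i).smul _)
        ((pole_XY_Y i i).congr (by simp) rfl) (-1) (-1 - k) B
      rw [hidx] at h
      simpa [delta_self] using h
    α_f := fun k B => by
      simpa using SimplePole.prodₗ_of_zero (homog_XY i) (homog_psi i)
        ((pole_XY_fermion i (isFermion_psi i)).congr (by simp) rfl) (-1) (-1 - k) B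
    α_g := fun k B => by
      simpa using SimplePole.prodₗ_of_zero (homog_XY i) (homog_chi i)
        ((pole_XY_fermion i (isFermion_chi i)).congr (by simp) rfl) (-1) (-1 - k) B
    β_x := fun k B => by
      simpa using SimplePole.prodₗ_of_zero (homog_psichi i) (homog_X i)
        ((pole_psichi_boson i (isBoson_X i)).congr (by simp) rfl) (-1) (-1 - k) B
    β_y := fun k B => by
      simpa using SimplePole.prodₗ_of_zero (homog_psichi i) (homog_Y i)
        ((pole_psichi_boson i (isBoson_Y i)).congr (by simp) rfl) (-1) (-1 - k) B
    β_f := fun k B => by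
      have h := SimplePole.prodₗ (homog_psichi i) (homog_psi i) ((homog_psi i).smul _)
        ((pole_psichi_psi i i).congr (by simp) rfl) (-1) (-1 - k) B
      rw [hidx] at h
      simpa [delta_self] using h
    β_g := fun k B => by
      have h := SimplePole.prodₗ (homog_psichi i) (homog_chi i) ((homog_chi i).smul _)
        ((pole_psichi_chi i i).congr (by simp) rfl) (-1) (-1 - k) B
      rw [hidx] at h
      simpa [delta_self, sub_eq_add_neg] using h
    μ_y := fun k B => by
      have h := SimplePole.prodₗ (homog_Mplus i) (homog_Y i) ((homog_psi i).smul _)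
        ((pole_Mplus_Y i i).congr (by simp) rfl) (-1) (-1 - k) B
      rw [hidx] at h
      simpa [delta_self] using h
    μ_g := fun k B => by
      have h := SimplePole.prodₗ (homog_Mplus i) (homog_chi i) ((homog_X i).add_two.smul _)
        ((pole_Mplus_chi i i).congr (by simp) rfl) (-1) (-1 - k) B
      rw [hidx] at h
      simpa [delta_self, neg_one_smul_field] using h
    ν_x := fun k B => by
      have h := SimplePole.prodₗ (homog_Mminus i) (homog_X i) ((homog_chi i).smul _)
        ((pole_Mminus_X i i).congr (by simp) rfl) (-1) (-1 - k) B
      rw [hidx] at h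
      simpa [delta_self, sub_eq_add_neg] using h
    ν_f := fun k B => by
      have h := SimplePole.prodₗ (homog_Mminus i) (homog_psi i) ((homog_Y i).add_two.smul _)
        ((pole_Mminus_psi i i).congr (by simp) rfl) (-1) (-1 - k) B
      rw [hidx] at h
      simpa [delta_self, neg_one_smul_field] using h
    α_o := by simp [prodₗ_apply, prod_neg_one_one, nop]
    β_o := by simp [prodₗ_apply, prod_neg_one_one, nop]
    μ_o := by simp [prodₗ_apply, prod_neg_one_one, nop, Mplus]
    ν_o := by simp [prodₗ_apply, prod_neg_one_one, nop, Mminus] }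

/-! ### Translation of the fields into words in left multiplications -/

theorem nop_eq_prodₗ (A B : FockField n) : nop A B = prodₗ (-1) A B := rfl

theorem calA_eq (i : Fin n) : calA i = -prodₗ (-1) (nop (X i) (Y i)) one := by
  rw [calA, prodₗ_apply, prod_neg_one_one]

theorem hatA_eq (i : Fin n) (O : FockField n) :
    hatA i O = -prodₗ (-1) (nop (X i) (Y i)) O := by
  rw [hatA, calA, nop_eq_prodₗ, map_neg, LinearMap.neg_apply]

theorem calD_eq (i : Fin n) (O : FockField n) : calD i O =
    -prodₗ (-1) (nop (X i) (Y i)) O + prodₗ (-1) (X i) (prodₗ (-1) (Y i) O) := by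
  rw [calD, ← hatA_eq]
  rfl

theorem prodₗ_current (i : Fin n) (B : FockField n) : prodₗ (-1) (current i) B =
    (prodₗ (-1) (nop (X i) (Y i)) + prodₗ (-1) (nop (psi i) (chi i))) B := by
  rw [current, map_add]

theorem current_eq (i : Fin n) : current i =
    (prodₗ (-1) (nop (X i) (Y i)) + prodₗ (-1) (nop (psi i) (chi i))) one := by
  rw [← prodₗ_current, prodₗ_apply, prod_neg_one_one]

theorem nopComm_eq (i : Fin n) : nopComm (Mplus i) (Mminus i) =
    prodₗ (-1) (Mplus i) (prodₗ (-1) (Mminus i) one) -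
      prodₗ (-1) (Mminus i) (prodₗ (-1) (Mplus i) one) := by
  simp only [nopComm, nop_eq_prodₗ, prodₗ_apply, prod_neg_one_one]

theorem T_eq (i : Fin n) : T i =
    (1 / 2 : ℂ) • nop (current i) (current i) -
      (1 / 2 : ℂ) • nopComm (Mplus i) (Mminus i) := by
  have h := (creationRelations i).quadratic
  simp only [Nat.cast_zero, sub_zero] at h
  rw [T, calD_eq, hatA_eq, calA_eq, h, nopComm_eq,
    nop_eq_prodₗ (current i), prodₗ_current, ← current_eq]

theorem der_nop (A B : FockField n) :
    der (nop A B) = prodₗ (-2) A (prodₗ (-1) B one) + prodₗ (-1) A (prodₗ (-2) B one) := by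
  simp only [nop, der_prod, prodₗ_apply, prod_neg_one_one, prod_neg_two_one]
  norm_num

/-- The factor `2` is common to all terms: the middle one appears twice in the Leibniz rule, and
`∂²A = 2 A_{(-3)} 1` in the outer ones. -/
theorem der_der_nop (A B : FockField n) : der (der (nop A B)) =
    (2 : ℂ) • (prodₗ (-3) A (prodₗ (-1) B one) + prodₗ (-2) A (prodₗ (-2) B one) +
      prodₗ (-1) A (prodₗ (-3) B one)) := by
  have hadd : ∀ C D : FockField n, der (C + D) = der C + der D := fun C D => by
    simp only [← prod_neg_two_one, ← prodₗ_apply, map_add, LinearMap.add_apply]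
  have hB : der (der B) = (2 : ℂ) • prod B (-3) one := by
    rw [← prod_neg_two_one B, der_prod, der_one, ← prodₗ_apply (-2) B 0, map_zero, add_zero]
    norm_num
  have hder : ∀ (p : ℤ) (C : FockField n), der (prodₗ p A C) =
      (-(p : ℂ)) • prodₗ (p - 1) A C + prodₗ p A (der C) := fun p C => der_prod A p C
  rw [der_nop, hadd, hder, hder]
  simp only [prodₗ_apply _ B one, prod_neg_one_one, prod_neg_two_one, hB, map_smul]
  norm_num
  module

theorem W_eq (i : Fin n) : W i = ((1 / 3 : ℂ) * (Real.sqrt (2 / 3) : ℂ)) •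
    ((3 / 2 : ℂ) • (nop (Mplus i) (der (Mminus i)) + nop (Mminus i) (der (Mplus i))) +
      (3 / 2 : ℂ) • nop (current i) (nopComm (Mplus i) (Mminus i)) -
      nop (current i) (nop (current i) (current i)) - der (der (current i))) := by
  have h := (creationRelations i).cubic
  simp only [Nat.cast_zero, sub_zero, Nat.cast_one, Nat.cast_ofNat] at h
  -- Evaluates the indices `-1 - k` to `-2` and `-3`, the form in which derivatives of bilinears are
  -- expanded.
  norm_num only at h
  have hd : der (der (current i)) = der (der (nop (X i) (Y i))) +
      der (der (nop (psi i) (chi i))) := by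
    simp only [current, ← prod_neg_two_one, ← prodₗ_apply, map_add, LinearMap.add_apply]
  rw [W, calD_eq, calD_eq, calD_eq, hatA_eq, hatA_eq, hatA_eq, calA_eq, h]
  refine congrArg (((1 / 3 : ℂ) * (Real.sqrt (2 / 3) : ℂ)) • ·) ?_
  have e₁ : nop (Mplus i) (der (Mminus i)) = prodₗ (-1) (Mplus i)
      (prodₗ (-2) (Y i) (prodₗ (-1) (chi i) one) + prodₗ (-1) (Y i) (prodₗ (-2) (chi i) one)) :=
    congrArg _ (der_nop (Y i) (chi i))
  have e₂ : nop (Mminus i) (der (Mplus i)) = prodₗ (-1) (Mminus i)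
      (prodₗ (-2) (X i) (prodₗ (-1) (psi i) one) + prodₗ (-1) (X i) (prodₗ (-2) (psi i) one)) :=
    congrArg _ (der_nop (X i) (psi i))
  have e₃ : ∀ B, nop (current i) B =
      (prodₗ (-1) (nop (X i) (Y i)) + prodₗ (-1) (nop (psi i) (chi i))) B := prodₗ_current i
  rw [e₁, e₂, hd, der_der_nop, der_der_nop, nopComm_eq, smul_add (2 : ℂ)]
  simp only [e₃, ← current_eq]

/-! ### Generated subalgebras -/

theorem one_mem_generatedBy (S : Set (FockField n)) : one ∈ generatedBy S :=
  Submodule.mem_sInf.2 fun _ hM => hM.1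

theorem subset_generatedBy (S : Set (FockField n)) : S ⊆ generatedBy S :=
  fun _ hA => Submodule.mem_sInf.2 fun _ hM => hM.2.1 hA

theorem prod_mem_generatedBy {S : Set (FockField n)} {A B : FockField n}
    (hA : A ∈ generatedBy S) (p : ℤ) (hB : B ∈ generatedBy S) : prod A p B ∈ generatedBy S :=
  Submodule.mem_sInf.2 fun M hM => hM.2.2 A (Submodule.mem_sInf.1 hA M hM) B
    (Submodule.mem_sInf.1 hB M hM) p

theorem der_mem_generatedBy {S : Set (FockField n)} {A : FockField n}
    (hA : A ∈ generatedBy S) : der A ∈ generatedBy S := by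
  rw [← prod_neg_two_one]
  exact prod_mem_generatedBy hA _ (one_mem_generatedBy S)

theorem generatedBy_le {S : Set (FockField n)} {M : Submodule ℂ (FockField n)} (h1 : one ∈ M)
    (hS : S ⊆ M) (hM : ∀ A ∈ M, ∀ B ∈ M, ∀ p : ℤ, prod A p B ∈ M) : generatedBy S ≤ M :=
  sInf_le ⟨h1, hS, hM⟩

theorem X_mem (i : Fin n) : X i ∈ fullAlgebra n := subset_generatedBy _ (by simp)
theorem Y_mem (i : Fin n) : Y i ∈ fullAlgebra n := subset_generatedBy _ (by simp)
theorem psi_mem (i : Fin n) : psi i ∈ fullAlgebra n := subset_generatedBy _ (by simp)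
theorem chi_mem (i : Fin n) : chi i ∈ fullAlgebra n := subset_generatedBy _ (by simp)
theorem b_mem (a : Fin (n - 1)) : (b a : FockField n) ∈ fullAlgebra n :=
  subset_generatedBy _ (by simp)

theorem current_mem (i : Fin n) : current i ∈ fullAlgebra n :=
  add_mem (prod_mem_generatedBy (X_mem i) _ (Y_mem i))
    (prod_mem_generatedBy (psi_mem i) _ (chi_mem i))

theorem Mplus_mem (i : Fin n) : Mplus i ∈ fullAlgebra n :=
  prod_mem_generatedBy (X_mem i) _ (psi_mem i)

theorem Mminus_mem (i : Fin n) : Mminus i ∈ fullAlgebra n :=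
  prod_mem_generatedBy (Y_mem i) _ (chi_mem i)

/-! ### BRST cohomology -/

theorem Q_eq_prodₗ (A : FockField n) : Q A = prodₗ 0 (currentBRST n) A := rfl

theorem Q_prod (A : FockField n) (p : ℤ) (B : FockField n) :
    Q (prod A p B) = prod (Q A) p B + prod (conj A) p (Q B) :=
  prod_zero_prod homog_currentBRST A p B

theorem Q_one : Q (one : FockField n) = 0 := by
  refine Q_eq_of_simplePole homog_one fun k l => ?_
  rw [ncoeff_one, map_zero]
  split_ifs <;> simp

theorem Q_prod_eq_zero {A B : FockField n} (hA : Q A = 0) (p : ℤ) (hB : Q B = 0) :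
    Q (prod A p B) = 0 := by
  rw [Q_prod, hA, hB, ← prodₗ_apply, ← prodₗ_apply, map_zero, map_zero, LinearMap.zero_apply,
    add_zero]

/-- The kernel of a derivation that annihilates the identity is stable under all products. -/
theorem Q_eq_zero_of_mem_generatedBy {S : Set (FockField n)} (hS : ∀ A ∈ S, Q A = 0)
    {A : FockField n} (hA : A ∈ generatedBy S) : Q A = 0 :=
  generatedBy_le (M := LinearMap.ker (prodₗ 0 (currentBRST n))) Q_one hS
    (fun _ hA _ hB p => Q_prod_eq_zero hA p hB) hA

theorem brstEquiv_iff {A B : FockField n} :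
    BRSTEquiv A B ↔ A - B ∈ (fullAlgebra n).map (prodₗ 0 (currentBRST n)) :=
  ⟨fun ⟨C, hC, h⟩ => ⟨C, hC, h.symm⟩, fun ⟨C, hC, h⟩ => ⟨C, hC, h.symm⟩⟩

theorem BRSTEquiv.refl (A : FockField n) : BRSTEquiv A A := by
  rw [brstEquiv_iff, sub_self]
  exact zero_mem _

theorem BRSTEquiv.symm {A B : FockField n} (h : BRSTEquiv A B) : BRSTEquiv B A := by
  rw [brstEquiv_iff, ← neg_sub]
  exact neg_mem (brstEquiv_iff.1 h)

theorem BRSTEquiv.trans {A B C : FockField n} (h : BRSTEquiv A B) (h' : BRSTEquiv B C) :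
    BRSTEquiv A C := by
  rw [brstEquiv_iff, ← sub_add_sub_cancel A B C]
  exact add_mem (brstEquiv_iff.1 h) (brstEquiv_iff.1 h')

theorem BRSTEquiv.add {A A' B B' : FockField n} (h : BRSTEquiv A A') (h' : BRSTEquiv B B') :
    BRSTEquiv (A + B) (A' + B') := by
  rw [brstEquiv_iff, add_sub_add_comm]
  exact add_mem (brstEquiv_iff.1 h) (brstEquiv_iff.1 h')

theorem BRSTEquiv.sub {A A' B B' : FockField n} (h : BRSTEquiv A A') (h' : BRSTEquiv B B') :
    BRSTEquiv (A - B) (A' - B') := by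
  rw [brstEquiv_iff, sub_sub_sub_comm]
  exact sub_mem (brstEquiv_iff.1 h) (brstEquiv_iff.1 h')

theorem BRSTEquiv.smul {A A' : FockField n} (r : ℂ) (h : BRSTEquiv A A') :
    BRSTEquiv (r • A) (r • A') := by
  have hr : r • A - r • A' = r • (A - A') := by module
  rw [brstEquiv_iff, hr]
  exact Submodule.smul_mem _ r (brstEquiv_iff.1 h)

/-- The products are well defined on the cohomology. -/
theorem BRSTEquiv.prod {A A' B B' : FockField n} (hA : BRSTEquiv A A') (hB : BRSTEquiv B B')
    (p : ℤ) (even : Homog 0 A) (mem : A ∈ fullAlgebra n) (mem' : B' ∈ fullAlgebra n)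
    (closed : Q A = 0) (closed' : Q B' = 0) :
    BRSTEquiv (BoundaryVOA.prod A p B) (BoundaryVOA.prod A' p B') := by
  obtain ⟨C, hC, hAC⟩ := hA
  obtain ⟨D, hD, hBD⟩ := hB
  -- The difference splits as `A_{(p)} (B - B') + (A - A')_{(p)} B'`. As `A` is even and closed, `Q`
  -- passes to `D` in the first term without a sign; as `B'` is closed, `Q` acts only on `C` in the
  -- second.
  refine ⟨BoundaryVOA.prod A p D + BoundaryVOA.prod C p B',
    add_mem (prod_mem_generatedBy mem p hD) (prod_mem_generatedBy hC p mem'), ?_⟩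
  have hconj : conj A = A := by simpa using homog_iff.1 even
  rw [Q_eq_prodₗ, map_add, ← Q_eq_prodₗ, ← Q_eq_prodₗ, Q_prod, Q_prod, closed, closed', hconj,
    ← hAC, ← hBD]
  simp only [← prodₗ_apply, map_sub, map_zero, LinearMap.sub_apply, LinearMap.zero_apply]
  abel

/-- `Q` commutes with the derivative because it annihilates the identity; no parity condition on the
primitive is needed. -/
theorem BRSTEquiv.der {A A' : FockField n} (h : BRSTEquiv A A') :
    BRSTEquiv (BoundaryVOA.der A) (BoundaryVOA.der A') := by
  obtain ⟨C, hC, hAC⟩ := h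
  refine ⟨BoundaryVOA.der C, der_mem_generatedBy hC, ?_⟩
  rw [← prod_neg_two_one C, Q_prod, Q_one, ← hAC, ← prod_neg_two_one, ← prod_neg_two_one]
  simp only [← prodₗ_apply, map_sub, map_zero, LinearMap.sub_apply, add_zero]

/-- Adjacent currents differ by `Q b_a`, and the nodes form a chain, so every current is compared
with the one at the first node. -/
theorem current_equiv_current (i j : Fin n) : BRSTEquiv (current i) (current j) := by
  have h : ∀ (k : ℕ) (hk : k < n), BRSTEquiv (current ⟨0, by omega⟩) (current (⟨k, hk⟩ : Fin n)) := by
    intro k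
    induction k with
    | zero => exact fun _ => .refl _
    | succ k ih =>
      intro hk
      refine (ih (by omega)).trans ⟨b ⟨k, by omega⟩, b_mem _, ?_⟩
      rw [Q_b, gauge, node, nodeSucc]
  exact (h i i.2).symm.trans (h j j.2)

theorem U_add_UF_eq : U n + UF n = (-(1 / (n : ℂ))) • ∑ i : Fin n, current i := by
  rw [U, UF, ← smul_add, ← Finset.sum_add_distrib]
  rfl

/-- `U + U_F` is minus the average of the currents, and all of them are equivalent to `J_i`.
Division by `n` is legitimate since an index `i` exists. -/
theorem neg_current_equiv (i : Fin n) : BRSTEquiv (-current i) (U n + UF n) := by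
  have hn : (n : ℂ) ≠ 0 := by
    have := i.pos
    exact_mod_cast this.ne'
  have h : -current i - (U n + UF n) = (1 / (n : ℂ)) • ∑ j : Fin n, (current j - current i) := by
    rw [U_add_UF_eq, Finset.sum_sub_distrib, Finset.sum_const, Finset.card_univ, Fintype.card_fin,
      ← Nat.cast_smul_eq_nsmul ℂ]
    match_scalars <;> field_simp
  rw [brstEquiv_iff, h]
  exact Submodule.smul_mem _ _ (sum_mem fun j _ => brstEquiv_iff.1 (current_equiv_current j i))

/-! ### The expressions for `T_i` and `W_i` -/

/-- The expression for `T_i` in terms of `N` and `M_i^±`. -/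
def quadraticForm (N : FockField n) (i : Fin n) : FockField n :=
  (1 / 2 : ℂ) • nop N N - (1 / 2 : ℂ) • nopComm (Mplus i) (Mminus i)

/-- The expression for `W_i` in terms of `N` and `M_i^±`. -/
def cubicForm (N : FockField n) (i : Fin n) : FockField n :=
  ((1 / 3 : ℂ) * (Real.sqrt (2 / 3) : ℂ)) •
    ((3 / 2 : ℂ) • (nop (Mplus i) (der (Mminus i)) + nop (Mminus i) (der (Mplus i))) -
      (3 / 2 : ℂ) • nop N (nopComm (Mplus i) (Mminus i)) + nop N (nop N N) + der (der N))

theorem nop_neg (A B : FockField n) : nop A (-B) = -nop A B := (prodₗ (-1) A).map_neg B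

theorem neg_nop (A B : FockField n) : nop (-A) B = -nop A B := by
  rw [nop_eq_prodₗ, map_neg]
  rfl

theorem der_neg (A : FockField n) : der (-A) = -der A := by
  rw [← prod_neg_two_one, ← prod_neg_two_one, ← prodₗ_apply, map_neg]
  rfl

theorem T_eq_quadraticForm (i : Fin n) : T i = quadraticForm (-current i) i := by
  rw [T_eq, quadraticForm, nop_neg, neg_nop, neg_neg]

theorem W_eq_cubicForm (i : Fin n) : W i = cubicForm (-current i) i := by
  rw [W_eq, cubicForm]
  simp only [nop_neg, neg_nop, neg_neg, der_neg]
  module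

theorem nopComm_mem {S : Set (FockField n)} {A B : FockField n} (hA : A ∈ generatedBy S)
    (hB : B ∈ generatedBy S) : nopComm A B ∈ generatedBy S :=
  sub_mem (prod_mem_generatedBy hA _ hB) (prod_mem_generatedBy hB _ hA)

theorem quadraticForm_mem {S : Set (FockField n)} {N : FockField n} {i : Fin n}
    (hN : N ∈ generatedBy S) (h₁ : Mplus i ∈ generatedBy S) (h₂ : Mminus i ∈ generatedBy S) :
    quadraticForm N i ∈ generatedBy S :=
  sub_mem (Submodule.smul_mem _ _ (prod_mem_generatedBy hN _ hN))
    (Submodule.smul_mem _ _ (nopComm_mem h₁ h₂))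

theorem cubicForm_mem {S : Set (FockField n)} {N : FockField n} {i : Fin n}
    (hN : N ∈ generatedBy S) (h₁ : Mplus i ∈ generatedBy S) (h₂ : Mminus i ∈ generatedBy S) :
    cubicForm N i ∈ generatedBy S :=
  Submodule.smul_mem _ _ (add_mem (add_mem (sub_mem (Submodule.smul_mem _ _
    (add_mem (prod_mem_generatedBy h₁ _ (der_mem_generatedBy h₂))
      (prod_mem_generatedBy h₂ _ (der_mem_generatedBy h₁))))
    (Submodule.smul_mem _ _ (prod_mem_generatedBy hN _ (nopComm_mem h₁ h₂))))
    (prod_mem_generatedBy hN _ (prod_mem_generatedBy hN _ hN)))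
    (der_mem_generatedBy (der_mem_generatedBy hN)))

theorem Homog.der {e : ℕ} {A : FockField n} (hA : Homog e A) : Homog e (BoundaryVOA.der A) := by
  rw [← prod_neg_two_one]
  exact hA.prod homog_one _

theorem homog_nopComm (i : Fin n) : Homog 0 (nopComm (Mplus i) (Mminus i)) :=
  (((homog_Mplus i).prod (homog_Mminus i) _).sub
    ((homog_Mminus i).prod (homog_Mplus i) _)).mod_two

theorem homog_quadraticForm {N : FockField n} (hN : Homog 0 N) (i : Fin n) :
    Homog 0 (quadraticForm N i) :=
  Homog.sub ((hN.prod hN _).smul _) ((homog_nopComm i).smul _)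

theorem homog_cubicForm {N : FockField n} (hN : Homog 0 N) (i : Fin n) :
    Homog 0 (cubicForm N i) :=
  Homog.smul ((((((homog_Mplus i).prod (homog_Mminus i).der _).add
    ((homog_Mminus i).prod (homog_Mplus i).der _)).mod_two.smul _).sub
    ((hN.prod (homog_nopComm i) _).smul _)).add (hN.prod (hN.prod hN _) _) |>.add hN.der.der) _

theorem Q_nopComm (i : Fin n) : Q (nopComm (Mplus i) (Mminus i)) = 0 :=
  Q_eq_zero_of_mem_generatedBy (S := {Mplus i, Mminus i})
    (by rintro A (rfl | rfl); exacts [Q_Mplus i, Q_Mminus i])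
    (nopComm_mem (subset_generatedBy _ (by simp)) (subset_generatedBy _ (by simp)))

theorem quadraticForm_equiv {N N' : FockField n} (h : BRSTEquiv N N') (even : Homog 0 N)
    (mem : N ∈ fullAlgebra n) (mem' : N' ∈ fullAlgebra n) (closed : Q N = 0) (closed' : Q N' = 0)
    (i : Fin n) : BRSTEquiv (quadraticForm N i) (quadraticForm N' i) :=
  ((h.prod h _ even mem mem' closed closed').smul _).sub (.refl _)

theorem cubicForm_equiv {N N' : FockField n} (h : BRSTEquiv N N') (even : Homog 0 N)
    (mem : N ∈ fullAlgebra n) (mem' : N' ∈ fullAlgebra n) (closed : Q N = 0) (closed' : Q N' = 0)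
    (i : Fin n) : BRSTEquiv (cubicForm N i) (cubicForm N' i) :=
  BRSTEquiv.smul _ ((((BRSTEquiv.refl _).sub ((h.prod (.refl _) _ even mem
    (nopComm_mem (Mplus_mem i) (Mminus_mem i)) closed (Q_nopComm i)).smul _)).add
    (h.prod (h.prod h _ even mem mem' closed closed') _ even mem
      (prod_mem_generatedBy mem' _ mem') closed (Q_prod_eq_zero closed' _ closed'))).add h.der.der)

theorem U_add_UF_mem : U n + UF n ∈ fullAlgebra n := by
  rw [U_add_UF_eq]
  exact Submodule.smul_mem _ _ (sum_mem fun i _ => current_mem i)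

theorem Q_U_add_UF : Q (U n + UF n) = 0 := by
  rw [U_add_UF_eq, Q_eq_prodₗ, map_smul, map_sum]
  simp only [← Q_eq_prodₗ, Q_current, Finset.sum_const_zero, smul_zero]

theorem Q_neg_current (i : Fin n) : Q (-current i) = 0 := by
  rw [Q_eq_prodₗ, map_neg, ← Q_eq_prodₗ, Q_current, neg_zero]

theorem homog_neg_current (i : Fin n) : Homog 0 (-current i) := by
  rw [← neg_one_smul_field]
  exact (homog_current i).smul _

theorem T_equiv (i : Fin n) : BRSTEquiv (T i) (quadraticForm (U n + UF n) i) := by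
  rw [T_eq_quadraticForm]
  exact quadraticForm_equiv (neg_current_equiv i) (homog_neg_current i) (neg_mem (current_mem i))
    U_add_UF_mem (Q_neg_current i) Q_U_add_UF i

theorem W_equiv (i : Fin n) : BRSTEquiv (W i) (cubicForm (U n + UF n) i) := by
  rw [W_eq_cubicForm]
  exact cubicForm_equiv (neg_current_equiv i) (homog_neg_current i) (neg_mem (current_mem i))
    U_add_UF_mem (Q_neg_current i) Q_U_add_UF i

/-! ### The subalgebra generated by `T_i` and `W_i` -/

theorem Q_eq_zero_of_mem_target {i : Fin n} {B : FockField n}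
    (hB : B ∈ generatedBy {U n + UF n, Mplus i, Mminus i}) : Q B = 0 :=
  Q_eq_zero_of_mem_generatedBy
    (by rintro A (rfl | rfl | rfl); exacts [Q_U_add_UF, Q_Mplus i, Q_Mminus i]) hB

theorem target_le_fullAlgebra (i : Fin n) :
    generatedBy {U n + UF n, Mplus i, Mminus i} ≤ fullAlgebra n :=
  generatedBy_le (one_mem_generatedBy _)
    (by rintro A (rfl | rfl | rfl); exacts [U_add_UF_mem, Mplus_mem i, Mminus_mem i])
    fun _ hA _ hB p => prod_mem_generatedBy hA p hB

/-- The even closed fields whose class is represented in the subalgebra generated by `U + U_F` and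
`M_i^±`. -/
def represented (i : Fin n) : Submodule ℂ (FockField n) where
  carrier := {A | A ∈ fullAlgebra n ∧ Homog 0 A ∧ Q A = 0 ∧
    ∃ B ∈ generatedBy {U n + UF n, Mplus i, Mminus i}, BRSTEquiv A B}
  zero_mem' := ⟨zero_mem _, by rw [homog_iff, map_zero, smul_zero],
    map_zero (prodₗ 0 (currentBRST n)), 0, zero_mem _, .refl _⟩
  add_mem' := fun ⟨m, e, q, B, hB, h⟩ ⟨m', e', q', B', hB', h'⟩ =>
    ⟨add_mem m m', e.add e', by rw [Q_eq_prodₗ, map_add, ← Q_eq_prodₗ, q, ← Q_eq_prodₗ, q', add_zero],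
      B + B', add_mem hB hB', h.add h'⟩
  smul_mem' := fun r _ ⟨m, e, q, B, hB, h⟩ =>
    ⟨Submodule.smul_mem _ r m, e.smul r, by rw [Q_eq_prodₗ, map_smul, ← Q_eq_prodₗ, q, smul_zero],
      r • B, Submodule.smul_mem _ r hB, h.smul r⟩

theorem mem_represented {i : Fin n} {A : FockField n} : A ∈ represented i ↔
    A ∈ fullAlgebra n ∧ Homog 0 A ∧ Q A = 0 ∧
      ∃ B ∈ generatedBy {U n + UF n, Mplus i, Mminus i}, BRSTEquiv A B := Iff.rfl

theorem generatedBy_le_represented (i : Fin n) : generatedBy {T i, W i} ≤ represented i := by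
  have hN := neg_mem (current_mem i)
  have hclosed : ∀ A ∈ ({-current i, Mplus i, Mminus i} : Set (FockField n)), Q A = 0 := by
    rintro A (rfl | rfl | rfl)
    exacts [Q_neg_current i, Q_Mplus i, Q_Mminus i]
  refine generatedBy_le ?_ ?_ ?_
  · exact mem_represented.2 ⟨one_mem_generatedBy _, homog_one, Q_one, one, one_mem_generatedBy _, .refl _⟩
  · rintro A (rfl | rfl)
    · refine mem_represented.2 ⟨?_, ?_, ?_, _, ?_, T_equiv i⟩
      · rw [T_eq_quadraticForm]
        exact quadraticForm_mem hN (Mplus_mem i) (Mminus_mem i)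
      · rw [T_eq_quadraticForm]
        exact homog_quadraticForm (homog_neg_current i) i
      · rw [T_eq_quadraticForm]
        exact Q_eq_zero_of_mem_generatedBy hclosed (quadraticForm_mem
          (subset_generatedBy _ (by simp)) (subset_generatedBy _ (by simp))
          (subset_generatedBy _ (by simp)))
      · exact quadraticForm_mem (subset_generatedBy _ (by simp)) (subset_generatedBy _ (by simp))
          (subset_generatedBy _ (by simp))
    · refine mem_represented.2 ⟨?_, ?_, ?_, _, ?_, W_equiv i⟩
      · rw [W_eq_cubicForm]
        exact cubicForm_mem hN (Mplus_mem i) (Mminus_mem i)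
      · rw [W_eq_cubicForm]
        exact homog_cubicForm (homog_neg_current i) i
      · rw [W_eq_cubicForm]
        exact Q_eq_zero_of_mem_generatedBy hclosed (cubicForm_mem
          (subset_generatedBy _ (by simp)) (subset_generatedBy _ (by simp))
          (subset_generatedBy _ (by simp)))
      · exact cubicForm_mem (subset_generatedBy _ (by simp)) (subset_generatedBy _ (by simp))
          (subset_generatedBy _ (by simp))
  · intro A hA A' hA' p
    obtain ⟨mA, eA, qA, B, hB, hAB⟩ := mem_represented.1 hA
    obtain ⟨mA', eA', qA', B', hB', hAB'⟩ := mem_represented.1 hA'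
    -- Evenness is part of the invariant so that `Q` passes the first factor without a sign; the
    -- second representative is closed because the generators of the target are.
    exact mem_represented.2 ⟨prod_mem_generatedBy mA p mA', eA.prod eA' p, Q_prod_eq_zero qA p qA', prod B p B',
      prod_mem_generatedBy hB p hB', hAB.prod hAB' p eA mA (target_le_fullAlgebra i hB') qA
      (Q_eq_zero_of_mem_target hB')⟩

end BoundaryVOA

end

theorem mainTheorem8 (n : ℕ) (i : Fin n) :
    BRSTEquiv (W i)
      (((1 / 3 : ℂ) * (Real.sqrt (2 / 3) : ℂ)) •
        ((3 / 2 : ℂ) • (nop (Mplus i) (der (Mminus i)) + nop (Mminus i) (der (Mplus i))) -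
          (3 / 2 : ℂ) • nop (U n + UF n) (nopComm (Mplus i) (Mminus i)) +
          nop (U n + UF n) (nop (U n + UF n) (U n + UF n)) +
          der (der (U n + UF n)))) ∧
    BRSTEquiv (T i)
      ((1 / 2 : ℂ) • nop (U n + UF n) (U n + UF n) -
        (1 / 2 : ℂ) • nopComm (Mplus i) (Mminus i)) ∧
    ∀ A ∈ generatedBy {T i, W i}, Q A = 0 ∧
      ∃ B ∈ generatedBy {U n + UF n, Mplus i, Mminus i}, Q B = 0 ∧ BRSTEquiv A B := by
  refine ⟨BoundaryVOA.W_equiv i, BoundaryVOA.T_equiv i, fun A hA => ?_⟩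
  obtain ⟨-, -, hQ, B, hB, hAB⟩ :=
    BoundaryVOA.mem_represented.1 (BoundaryVOA.generatedBy_le_represented i hA)
  exact ⟨hQ, B, hB, BoundaryVOA.Q_eq_zero_of_mem_target hB, hAB⟩
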